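/- Let $\mathcal X$ be a reflexive real Banach space with dual $\mathcal X^*$. For $f\colon\mathcal X\to\left]-\infty,+\infty\right]$ write $\operatorname{dom}f=\{x : f(x)<+\infty\}$, and let $\Gamma_0(\mathcal X)$ be the class of lower semicontinuous convex functions $f\colon\mathcal X\to\left]-\infty,+\infty\right]$ with $\operatorname{dom} f\neq\varnothing$. A function $f\in\Gamma_0(\mathcal X)$ is essentially smooth if $\partial f$ is locally bounded and single-valued on its domain; it is essentially strictly convex if $\partial f^*$ is locally bounded on its domain and $f$ is strictly convex on every convex subset of $\operatorname{dom}\partial f$, where $f^*$ is the conjugate of $f$. If $f$ is Gâteaux differentiable on $\operatorname{int}\operatorname{dom} f\neq\varnothing$, its Bregman distance is $D_f(x,y)=f(x)-f(y)-\langle x-y,\nabla f(y)\rangle$ if $y\in\operatorname{int}\operatorname{dom}f$, and $D_f(x,y)=+\infty$ otherwise. For $\alpha>0$, $\mathcal C_\alpha(f)$ is the set of all $g\in\Gamma_0(\mathcal X)$ such that $\operatorname{dom}g=\operatorname{dom}f$, $g$ is Gâteaux differentiable on $\operatorname{int}\operatorname{dom}f$, and $D_g\geq\alpha D_f$. Gradients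 $\nabla g$ are regarded as operators with domain $\operatorname{int}\operatorname{dom}g$. **Setting.** Let $A,B\colon\mathcal X\to2^{\mathcal X^*}$ be maximally monotone and let $f\in\Gamma_0(\mathcal X)$ be essentially smooth. Set $C=(\operatorname{int}\operatorname{dom}f)\cap\operatorname{dom}A$ and $\mathscr S=(\operatorname{int}\operatorname{dom}f)\cap\operatorname{zer}(A+B)$. Suppose that $C\subset\operatorname{int}\operatorname{dom}B$, that $\mathscr S\neq\varnothing$, that $B$ is single-valued on $\operatorname{int}\operatorname{dom}B$, and that $\delta_1\in[0,1[$, $\delta_2\in[0,1]$ and $\kappa\in[0,+\infty[$ satisfy, for all $x,y\in C$, $z\in\mathscr S$, $y^*\in Ay$ and $z^*\in Az$, $$\langle y-x,By-Bz\rangle\leq\kappa D_f(x,y)+\langle y-z,\delta_1(y^*-z^*)+\delta_2(By-Bz)\rangle .$$ **Algorithm.** Let $\alpha>0$, let $(\gamma_n)_{n\in\mathbb N}$ be a sequence in $]0,+\infty[$, and let $(f_n)_{n\in\mathbb N}$ be a sequence in $\mathcal C_\alpha(f)$ such that: - $\inf_n\gamma_n>0$, $\sup_n(\kappa\gamma_n)\leq\alpha$,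 and $\sup_n(\delta_1\gamma_{n+1}/\gamma_n)<1$; - there is a summable sequence $(\eta_n)_{n\in\mathbb N}$ in $[0,+\infty[$ such that $D_{f_{n+1}}\leq(1+\eta_n)D_{f_n}$ for every $n$; - for every $n$, $\nabla f_n$ is strictly monotone on $C$ and $(\nabla f_n-\gamma_nB)(C)\subset\operatorname{ran}(\nabla f_n+\gamma_nA)$. Take $x_0\in C$ and, for every $n\in\mathbb N$, set $x_{n+1}=(\nabla f_n+\gamma_nA)^{-1}(\nabla f_n(x_n)-\gamma_nBx_n)$. **Proposition.** Let $(x_n)_{n\in\mathbb N}$ be a sequence generated by this algorithm and suppose that one of the following holds: - [a] $\overline{\operatorname{dom}}f\cap\overline{\operatorname{dom}}A\subset\operatorname{int}\operatorname{dom}f$; - [b] $f$ is essentially strictly convex, $\operatorname{dom}f^*$ is open, and $\nabla f^*$ is weakly sequentially continuous; - [c] $f$ is strictly convex on $\operatorname{int}\operatorname{dom}f$ and $$\rho=\inf_{\substack{x,y\in\operatorname{int}\operatorname{dom}f\\ x\neq y}}\frac{D_f(x,y)}{D_f(y,x)}\in\left]0,+\infty\right[;$$ - [d] $\mathcal X$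 is finite-dimensional. Then every weak sequential cluster point of $(x_n)_{n\in\mathbb N}$ lies in $\operatorname{int}\operatorname{dom}f$. -/

import Mathlib

open Set Filter Topology
open scoped Pointwise

noncomputable section

namespace BregmanFB

section Functions

variable {E : Type*} [NormedAddCommGroup E] [NormedSpace ℝ E]

/-- The effective domain `{x | f x < +∞}` of an extended-real-valued function. -/
def effDom (f : E → EReal) : Set E := {x | f x < ⊤}

/-- The class `Γ₀(E)`: proper lower semicontinuous convex functions `E → ]-∞, +∞]`. -/
structure IsGamma0 (f : E → EReal) : Prop where
  ne_bot : ∀ x, f x ≠ ⊥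
  nonempty : (effDom f).Nonempty
  lsc : LowerSemicontinuous f
  convex : ∀ x y : E, ∀ a b : ℝ, 0 < a → 0 < b → a + b = 1 →
    f (a • x + b • y) ≤ (a : EReal) * f x + (b : EReal) * f y

/-- The Fenchel conjugate `f* : E* → [-∞, +∞]`. -/
def conjugate (f : E → EReal) (u : StrongDual ℝ E) : EReal :=
  ⨆ x : E, ((u x : ℝ) : EReal) - f x

/-- `u` is the Gâteaux gradient of `f` at `x`: `x` is interior to `dom f` (so that `f` is
real-valued near `x` when it never takes the value `-∞`) and the directional derivative of `f`
at `x` along every `v` is `u v`. -/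
def HasGateauxGradAt (f : E → EReal) (u : StrongDual ℝ E) (x : E) : Prop :=
  x ∈ interior (effDom f) ∧
    ∀ v : E, HasLineDerivAt ℝ (fun y => (f y).toReal) (u v) x v

open Classical in
/-- The Gâteaux gradient `∇f x` (with the value `0` where it does not exist). -/
def grad (f : E → EReal) (x : E) : StrongDual ℝ E :=
  if h : ∃ u, HasGateauxGradAt f u x then h.choose else 0

open Classical in
/-- The Bregman distance `D_f(x, y)`. -/
def bregman (f : E → EReal) (x y : E) : EReal :=
  if y ∈ interior (effDom f) then f x - f y - ((grad f y (x - y) : ℝ) : EReal) else ⊤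

/-- The Bregman symmetry ratio: the infimum of `D_f(x, y) / D_f(y, x)` over distinct points `x`, `y`
of `int dom f`, with the convention `inf ∅ = +∞`. It is used for `f` strictly convex on `int dom f`,
in which case both distances are positive reals. -/
def bregmanSymmetryRatio (f : E → EReal) : EReal :=
  ⨅ (x ∈ interior (effDom f)) (y ∈ interior (effDom f)) (_ : x ≠ y),
    bregman f x y / bregman f y x

/-- The class `𝒞_α(f)`. -/
structure IsInClass (α : ℝ) (f g : E → EReal) : Prop where
  gamma0 : IsGamma0 g
  dom_eq : effDom g = effDom f
  differentiable : ∀ x ∈ interior (effDom f), ∃ u, HasGateauxGradAt g u x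
  bregman_ge : ∀ x y, (α : EReal) * bregman f x y ≤ bregman g x y

end Functions

section Operators

variable {E : Type*} [NormedAddCommGroup E] [NormedSpace ℝ E]

/-- The domain of a set-valued operator. -/
def opDom (M : E → Set (StrongDual ℝ E)) : Set E := {x | (M x).Nonempty}

/-- The range of a set-valued operator. -/
def opRan (M : E → Set (StrongDual ℝ E)) : Set (StrongDual ℝ E) := {u | ∃ x, u ∈ M x}

/-- The zeros of a set-valued operator. -/
def opZer (M : E → Set (StrongDual ℝ E)) : Set E := {x | 0 ∈ M x}

/-- The inverse of a set-valued operator. -/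
def opInv (M : E → Set (StrongDual ℝ E)) (u : StrongDual ℝ E) : Set E := {x | u ∈ M x}

def IsMonotoneOp (M : E → Set (StrongDual ℝ E)) : Prop :=
  ∀ x y : E, ∀ u ∈ M x, ∀ v ∈ M y, 0 ≤ (u - v) (x - y)

/-- Maximal monotonicity: no monotone operator has a strictly larger graph. -/
def IsMaximallyMonotone (M : E → Set (StrongDual ℝ E)) : Prop :=
  IsMonotoneOp M ∧
    ∀ N : E → Set (StrongDual ℝ E), IsMonotoneOp N → (∀ x, M x ⊆ N x) → N = M

/-- The subdifferential `∂f`. -/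
def subdiff (f : E → EReal) (x : E) : Set (StrongDual ℝ E) :=
  {u | ∀ y, ((u (y - x) : ℝ) : EReal) + f x ≤ f y}

/-- `∇f` as a set-valued operator with domain in `int dom f`. -/
def gradOp (f : E → EReal) (x : E) : Set (StrongDual ℝ E) := {u | HasGateauxGradAt f u x}

/-- `M` is locally bounded on its domain. -/
def IsLocallyBoundedOnDom (M : E → Set (StrongDual ℝ E)) : Prop :=
  ∀ x ∈ opDom M, ∃ U ∈ 𝓝 x, Bornology.IsBounded (⋃ y ∈ U, M y)

/-- Essential smoothness: `∂f` is locally bounded and single-valued on its domain. -/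
def EssentiallySmooth (f : E → EReal) : Prop :=
  IsLocallyBoundedOnDom (subdiff f) ∧ ∀ x ∈ opDom (subdiff f), ∃ u, subdiff f x = {u}

/-- Essential strict convexity: `∂f*` is locally bounded on its domain and `f` is strictly convex
on every convex subset of `dom ∂f`. Here `∂f*` takes its values in the bidual, which is identified
isometrically with the space itself when the latter is reflexive; for `f ∈ Γ₀`, `f` is real-valued
on `dom ∂f`, so that taking `toReal` is harmless. -/
def EssentiallyStrictlyConvex (f : E → EReal) : Prop :=
  IsLocallyBoundedOnDom (subdiff (conjugate f)) ∧
    ∀ S ⊆ opDom (subdiff f), Convex ℝ S → StrictConvexOn ℝ S (fun x => (f x).toReal)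

end Operators

section Weak

variable {E F : Type*} [NormedAddCommGroup E] [NormedSpace ℝ E]
  [NormedAddCommGroup F] [NormedSpace ℝ F]

/-- Weak convergence `xₙ ⇀ x`. -/
def WeakTendsto (x : ℕ → E) (l : E) : Prop :=
  Tendsto (fun n => toWeakSpace ℝ E (x n)) atTop (𝓝 (toWeakSpace ℝ E l))

/-- The set of weak sequential cluster points of a sequence. -/
def weakSeqClusterPts (x : ℕ → E) : Set E :=
  {l | ∃ k : ℕ → ℕ, StrictMono k ∧ WeakTendsto (x ∘ k) l}

/-- Weak sequential continuity of an operator defined on `S`. -/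
def WeaklySeqContinuousOn (T : E → F) (S : Set E) : Prop :=
  ∀ u : ℕ → E, (∀ n, u n ∈ S) → ∀ l ∈ S, WeakTendsto u l → WeakTendsto (T ∘ u) (T l)

end Weak

section Algorithm

variable {X : Type*} [NormedAddCommGroup X] [NormedSpace ℝ X]

/-- Reflexivity: the canonical embedding into the bidual is onto. -/
def IsReflexive (X : Type*) [NormedAddCommGroup X] [NormedSpace ℝ X] : Prop :=
  Function.Surjective (NormedSpace.inclusionInDoubleDual ℝ X)

/-- `C = (int dom f) ∩ dom A`. -/
def setC (A : X → Set (StrongDual ℝ X)) (f : X → EReal) : Set X :=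
  interior (effDom f) ∩ opDom A

/-- `𝒮 = (int dom f) ∩ zer (A + B)`. -/
def solSet (A B : X → Set (StrongDual ℝ X)) (f : X → EReal) : Set X :=
  interior (effDom f) ∩ opZer (A + B)

/-- The setting of the monotone inclusion problem: find `x ∈ int dom f` with `0 ∈ A x + B x`. -/
structure ProblemSetting (A B : X → Set (StrongDual ℝ X)) (f : X → EReal)
    (δ₁ δ₂ κ : ℝ) : Prop where
  maxMono_A : IsMaximallyMonotone A
  maxMono_B : IsMaximallyMonotone B
  gamma0 : IsGamma0 f
  essSmooth : EssentiallySmooth f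
  C_subset : setC A f ⊆ interior (opDom B)
  sol_nonempty : (solSet A B f).Nonempty
  B_single : ∀ x ∈ interior (opDom B), ∃ b, B x = {b}
  δ₁_mem : δ₁ ∈ Ico (0 : ℝ) 1
  δ₂_mem : δ₂ ∈ Icc (0 : ℝ) 1
  κ_nonneg : 0 ≤ κ
  /-- `By`, `Bz` are the unique elements of `B y`, `B z`. -/
  ineq : ∀ x ∈ setC A f, ∀ y ∈ setC A f, ∀ z ∈ solSet A B f,
    ∀ ys ∈ A y, ∀ zs ∈ A z, ∀ By ∈ B y, ∀ Bz ∈ B z,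
      (((By - Bz) (y - x) : ℝ) : EReal) ≤
        (κ : EReal) * bregman f x y +
          (((δ₁ • (ys - zs) + δ₂ • (By - Bz)) (y - z) : ℝ) : EReal)

/-- `x` is a sequence generated by the Bregman forward-backward algorithm with parameters
`α`, `γ` and kernels `fs`. -/
structure GeneratedByAlgorithm (A B : X → Set (StrongDual ℝ X)) (f : X → EReal)
    (δ₁ δ₂ κ α : ℝ) (γ : ℕ → ℝ) (fs : ℕ → X → EReal) (x : ℕ → X) : Prop where
  setting : ProblemSetting A B f δ₁ δ₂ κ
  α_pos : 0 < α
  γ_pos : ∀ n, 0 < γ n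
  kernels : ∀ n, IsInClass α f (fs n)
  inf_γ : ∃ ε > 0, ∀ n, ε ≤ γ n
  sup_κγ : ∀ n, κ * γ n ≤ α
  sup_ratio : ∃ q < 1, ∀ n, δ₁ * γ (n + 1) / γ n ≤ q
  bregman_le : ∃ η : ℕ → ℝ, (∀ n, 0 ≤ η n) ∧ Summable η ∧
    ∀ n u v, bregman (fs (n + 1)) u v ≤ ((1 + η n : ℝ) : EReal) * bregman (fs n) u v
  strictMono : ∀ n, ∀ u ∈ setC A f, ∀ v ∈ setC A f, u ≠ v →
    0 < (grad (fs n) u - grad (fs n) v) (u - v)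
  range : ∀ n, ∀ u ∈ setC A f, ∀ b ∈ B u,
    grad (fs n) u - γ n • b ∈ opRan (gradOp (fs n) + γ n • A)
  start : x 0 ∈ setC A f
  step : ∀ n, ∃ b ∈ B (x n),
    x (n + 1) ∈ opInv (gradOp (fs n) + γ n • A) (grad (fs n) (x n) - γ n • b)

end Algorithm

end BregmanFB

end

open BregmanFB

namespace BregmanFB

/-! ### Weak convergence and weak sequential compactness. -/

section WeakConvergence

variable {E : Type*} [NormedAddCommGroup E] [NormedSpace ℝ E]

/-! The algorithm enters mainly through one estimate: for a solution z, the distances D_f(z, x_n)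
stay bounded (`GeneratedByAlgorithm.exists_bregman_le`). Indeed D_{f_n}(z, x_n) + δ₁γ_n⟨x_n - z,
x_n^* - z^*⟩ grows at most by the summable factors 1 + η_n, and it dominates αD_f(z, x_n).

Two facts about an essentially smooth f turn this bound into interiority. First, a bound on D_f(z,
y) with z interior bounds ‖∇f(y)‖, since f is bounded above near z (`exists_norm_grad_le`). Second,
dom ∂f ⊂ int dom f: at a boundary point a normal vector could be added to the subgradient
(`opDom_subdiff_subset`). It is therefore enough to exhibit a subgradient at the cluster point, and
the candidate in [b], [c] and [d] is a weak limit of gradients.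

In [d], convergence is strong, so lower semicontinuity passes the subgradient inequality to the
limit. In [c], D_f(x_n, z) is bounded too, which puts the weak limit x in dom f; the argument of [d]
is then run along the segment from z to x. In [b], the limit u of the gradients lies in dom f*, and
weak continuity of ∇f* = (∂f)⁻¹ forces u ∈ ∂f(x).

Case [a] needs no bound: the closure of dom f is convex, and weak limits of points of dom A lie in
its closure by maximal monotonicity and reflexivity. -/

theorem weakTendsto_iff {x : ℕ → E} {l : E} :
    WeakTendsto x l ↔ ∀ φ : StrongDual ℝ E, Tendsto (fun n => φ (x n)) atTop (𝓝 (φ l)) := by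
  have hinj : Function.Injective (topDualPairing ℝ E).flip := by
    intro a b hab
    by_contra hne
    obtain ⟨φ, hφ⟩ := geometric_hahn_banach_point_point hne
    exact hφ.ne (DFunLike.congr_fun hab φ)
  exact WeakBilin.tendsto_iff_forall_eval_tendsto _ hinj

/-- A closed convex set is weakly sequentially closed. -/
theorem WeakTendsto.mem_of_isClosed_of_convex {x : ℕ → E} {l : E} (h : WeakTendsto x l)
    {S : Set E} (hS : IsClosed S) (hSc : Convex ℝ S) (hx : ∀ n, x n ∈ S) : l ∈ S := by
  by_contra hl
  obtain ⟨φ, c, hφ, hc⟩ := geometric_hahn_banach_closed_point hSc hS hl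
  exact hc.not_ge (le_of_tendsto' (weakTendsto_iff.1 h φ) fun n => (hφ _ (hx n)).le)

theorem WeakTendsto.tendsto_of_finiteDimensional [FiniteDimensional ℝ E] {x : ℕ → E} {l : E}
    (h : WeakTendsto x l) : Tendsto x atTop (𝓝 l) := by
  let b := Module.finBasis ℝ E
  have hb : Tendsto (fun n => b.equivFunL (x n)) atTop (𝓝 (b.equivFunL l)) := by
    rw [tendsto_pi_nhds]
    intro i
    exact weakTendsto_iff.1 h
      ((ContinuousLinearMap.proj (R := ℝ) (φ := fun _ => ℝ) i).comp
        (b.equivFunL : E →L[ℝ] (Fin (Module.finrank ℝ E) → ℝ)))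
  simpa [Function.comp_def] using (b.equivFunL.symm.continuous.tendsto _).comp hb

/-- In the dual of a reflexive space, a bounded sequence has a weakly convergent subsequence. -/
theorem IsReflexive.exists_weakTendsto_subseq (hE : IsReflexive E) {u : ℕ → StrongDual ℝ E}
    {M : ℝ} (hu : ∀ n, ‖u n‖ ≤ M) :
    ∃ (l : StrongDual ℝ E) (k : ℕ → ℕ), StrictMono k ∧ WeakTendsto (u ∘ k) l := by
  -- Separability of the closed span Y yields countably many norming points d i. A diagonal
  -- subsequence converges at each d i, and two weak* cluster points in Y that agree on all d i
  -- coincide.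
  set Y : Submodule ℝ (StrongDual ℝ E) := (Submodule.span ℝ (range u)).topologicalClosure with hY
  have huY : ∀ n, u n ∈ Y := fun n =>
    Submodule.le_topologicalClosure _ (Submodule.subset_span (mem_range_self n))
  have hYsep : TopologicalSpace.IsSeparable (Y : Set (StrongDual ℝ E)) := by
    rw [hY, Submodule.topologicalClosure_coe]
    exact ((countable_range u).isSeparable.span (R := ℝ)).closure
  obtain ⟨D, hDc, hDY⟩ := hYsep
  obtain ⟨e, he⟩ : ∃ e : ℕ → StrongDual ℝ E, insert 0 D = range e :=
    (hDc.insert 0).exists_eq_range (insert_nonempty _ _)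
  have hnorming : ∀ i, ∃ d : E, ‖d‖ ≤ 1 ∧ e i d = ‖e i‖ := fun i => by
    obtain ⟨g, hg, hge⟩ := exists_dual_vector'' ℝ (e i)
    obtain ⟨d, rfl⟩ := hE g
    refine ⟨d, ?_, hge⟩
    have := (NormedSpace.inclusionInDoubleDualLi (E := E) ℝ).norm_map d
    exact this.symm.le.trans hg
  choose d hd1 hd using hnorming
  obtain ⟨a, -, k, hk, hka⟩ :=
    (isCompact_univ_pi fun _ : ℕ => isCompact_Icc (a := -M) (b := M)).tendsto_subseq
    (x := fun n i => u n (d i)) (fun n i _ => by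
      have : ‖u n (d i)‖ ≤ M := (u n).le_of_opNorm_le_of_le (hu n) (hd1 i) |>.trans (by simp)
      exact abs_le.1 this)
  rw [tendsto_pi_nhds] at hka
  let v : ℕ → WeakDual ℝ E := fun n => StrongDual.toWeakDual (u (k n))
  have hev : ∀ y : E, Continuous fun φ : WeakDual ℝ E => φ y := fun y =>
    WeakDual.eval_continuous y
  have hclus : ∀ φ : WeakDual ℝ E, MapClusterPt φ atTop v →
      (∀ i, φ (d i) = a i) ∧ WeakDual.toStrongDual φ ∈ Y := by
    intro φ hφ
    refine ⟨fun i => ?_, ?_⟩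
    · have h1 : MapClusterPt (φ (d i)) atTop (fun n => v n (d i)) :=
        hφ.continuousAt_comp (hev (d i)).continuousAt
      have h2 : Tendsto (fun n => v n (d i)) atTop (𝓝 (a i)) := hka i
      by_contra hne
      have := (h1.clusterPt.mono h2)
      exact hne (eq_of_nhds_neBot this)
    -- Reflexivity makes the separating functional an evaluation, hence weak* continuous, so the
    -- norm-closed subspace Y is weak* closed.
    · by_contra hφY
      obtain ⟨G, c, hG, hc⟩ := geometric_hahn_banach_closed_point Y.convex
        (Submodule.isClosed_topologicalClosure _) hφY
      obtain ⟨y, rfl⟩ := hE G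
      have h1 : ∃ᶠ n in atTop, v n ∈ {ψ : WeakDual ℝ E | c < ψ y} :=
        hφ.frequently ((isOpen_lt continuous_const (hev y)).mem_nhds hc)
      obtain ⟨n, hn⟩ := h1.exists
      exact (hG _ (huY (k n))).not_gt hn
  have hcpt := WeakDual.isCompact_closedBall (𝕜 := ℝ) (E := E) 0 M
  have hvmem : ∀ n, v n ∈ WeakDual.toStrongDual ⁻¹' Metric.closedBall (0 : StrongDual ℝ E) M :=
    fun n => mem_closedBall_zero_iff.2 (hu (k n))
  obtain ⟨l, -, hl⟩ := hcpt.exists_mapClusterPt (f := atTop) (u := v)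
    (tendsto_principal.2 (Eventually.of_forall hvmem))
  have huniq : ∀ ψ : WeakDual ℝ E, MapClusterPt ψ atTop v → ψ = l := by
    intro ψ hψ
    have hmem : WeakDual.toStrongDual ψ - WeakDual.toStrongDual l ∈ Y :=
      Y.sub_mem (hclus ψ hψ).2 (hclus l hl).2
    have hzero : ∀ i, (WeakDual.toStrongDual ψ - WeakDual.toStrongDual l) (d i) = 0 := fun i => by
      show ψ (d i) - l (d i) = 0
      rw [(hclus ψ hψ).1 i, (hclus l hl).1 i, sub_self]
    set w := WeakDual.toStrongDual ψ - WeakDual.toStrongDual l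
    have hw : w = 0 := by
      rw [← norm_le_zero_iff]
      refine le_of_forall_pos_le_add fun ε hε => ?_
      obtain ⟨b, hbD, hb⟩ := Metric.mem_closure_iff.1 (hDY hmem) (ε / 2) (by positivity)
      obtain ⟨i, rfl⟩ : b ∈ range e := he ▸ mem_insert_of_mem _ hbD
      -- As w vanishes at d i, which norms e i, the distance from e i to w is at least ‖e i‖; so an
      -- element w close to e i is itself small.
      have h1 : ‖e i‖ ≤ ‖e i - w‖ := by
        have : ‖e i‖ = (e i - w) (d i) := by simp [hzero i, hd i]
        rw [this]
        exact (le_abs_self _).trans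
          (((e i - w).le_of_opNorm_le_of_le le_rfl (hd1 i)).trans (by simp))
      have h2 : ‖w‖ ≤ ‖e i‖ + ‖e i - w‖ := by
        simpa [norm_sub_rev] using norm_le_norm_add_norm_sub (e i) w
      rw [dist_eq_norm, norm_sub_rev] at hb
      linarith
    exact sub_eq_zero.1 hw
  have hlim : Tendsto v atTop (𝓝 l) :=
    hcpt.tendsto_nhds_of_unique_mapClusterPt (Eventually.of_forall hvmem)
      fun ψ _ hψ => huniq ψ hψ
  refine ⟨WeakDual.toStrongDual l, k, hk, weakTendsto_iff.2 fun G => ?_⟩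
  obtain ⟨y, rfl⟩ := hE G
  exact ((hev y).tendsto l).comp hlim

end WeakConvergence

/-! ### Maximally monotone operators in reflexive spaces. -/

section MaximallyMonotone

variable {E : Type*} [NormedAddCommGroup E] [NormedSpace ℝ E]

theorem IsMaximallyMonotone.mem_of_forall {M : E → Set (StrongDual ℝ E)}
    (hM : IsMaximallyMonotone M) {x : E} {u : StrongDual ℝ E}
    (h : ∀ y, ∀ v ∈ M y, 0 ≤ (u - v) (x - y)) : u ∈ M x := by
  let N : E → Set (StrongDual ℝ E) := fun y => {v | v ∈ M y ∨ (y = x ∧ v = u)}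
  have hN : IsMonotoneOp N := by
    rintro y₁ y₂ v₁ (h₁ | ⟨rfl, rfl⟩) v₂ (h₂ | ⟨rfl, rfl⟩)
    · exact hM.1 _ _ _ h₁ _ h₂
    · have := h _ _ h₁
      rwa [← neg_sub v₁, ← neg_sub y₁, neg_apply, map_neg, neg_neg] at this
    · exact h _ _ h₂
    · simp
  have := hM.2 N hN fun y v hv => Or.inl hv
  rw [← this]
  exact Or.inr ⟨rfl, rfl⟩

/-- A nonempty set `G ⊆ E × E*` which contains every point monotonically related to it,
and is itself monotone, meets the graph of `-J`, where `J` is the duality map of the reflexive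
space `E`. -/
theorem exists_mem_graph_neg_duality (hE : IsReflexive E) {G : Set (E × StrongDual ℝ E)}
    (hne : G.Nonempty) (hmono : ∀ p ∈ G, ∀ q ∈ G, 0 ≤ (p.2 - q.2) (p.1 - q.1))
    (hmax : ∀ p : E × StrongDual ℝ E, (∀ q ∈ G, 0 ≤ (p.2 - q.2) (p.1 - q.1)) → p ∈ G) :
    ∃ p ∈ G, p.2 p.1 + ‖p.1‖ ^ 2 / 2 + ‖p.2‖ ^ 2 / 2 ≤ 0 := by
  have hpair : ∀ (p : E × StrongDual ℝ E), 0 ≤ p.2 p.1 + ‖p.1‖ ^ 2 / 2 + ‖p.2‖ ^ 2 / 2 := by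
    intro p
    have h1 := p.2.le_opNorm p.1
    have h2 := neg_abs_le (p.2 p.1)
    rw [Real.norm_eq_abs] at h1
    nlinarith [sq_nonneg (‖p.1‖ - ‖p.2‖)]
  -- V is the epigraph of the Fitzpatrick function of G, and U the strict hypograph of -(‖·‖²/2 +
  -- ‖·‖²/2). Maximality makes the Fitzpatrick function at least the duality pairing, which is at
  -- least minus the quadratic term, so a hyperplane separates U from V.
  let U : Set ((E × StrongDual ℝ E) × ℝ) :=
    {w | w.2 + (‖w.1.1‖ ^ 2 / 2 + ‖w.1.2‖ ^ 2 / 2) < 0}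
  let V : Set ((E × StrongDual ℝ E) × ℝ) :=
    {w | ∀ q ∈ G, q.2 w.1.1 + w.1.2 q.1 - q.2 q.1 ≤ w.2}
  have hUo : IsOpen U := isOpen_lt (by fun_prop) continuous_const
  have hsq : ∀ (s t a b : ℝ), 0 ≤ a → 0 ≤ b → a + b = 1 →
      (a * s + b * t) ^ 2 ≤ a * s ^ 2 + b * t ^ 2 := by
    intro s t a b ha hb hab
    obtain rfl : b = 1 - a := by linarith
    nlinarith [mul_nonneg (mul_nonneg ha hb) (sq_nonneg (s - t))]
  have hnsq : ∀ {F : Type _} [NormedAddCommGroup F] [NormedSpace ℝ F] (s t : F) (a b : ℝ),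
      0 ≤ a → 0 ≤ b → a + b = 1 → ‖a • s + b • t‖ ^ 2 ≤ a * ‖s‖ ^ 2 + b * ‖t‖ ^ 2 := by
    intro F _ _ s t a b ha hb hab
    refine le_trans ?_ (hsq _ _ a b ha hb hab)
    have : ‖a • s + b • t‖ ≤ a * ‖s‖ + b * ‖t‖ := by
      simpa [norm_smul, abs_of_nonneg ha, abs_of_nonneg hb] using norm_add_le (a • s) (b • t)
    gcongr
  have hUc : Convex ℝ U := by
    intro w hw w' hw' a b ha hb hab
    simp only [U, mem_ofPred_eq] at hw hw' ⊢
    have h1 := hnsq w.1.1 w'.1.1 a b ha hb hab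
    have h2 := hnsq w.1.2 w'.1.2 a b ha hb hab
    have h3 : a * (w.2 + (‖w.1.1‖ ^ 2 / 2 + ‖w.1.2‖ ^ 2 / 2)) +
        b * (w'.2 + (‖w'.1.1‖ ^ 2 / 2 + ‖w'.1.2‖ ^ 2 / 2)) < 0 := by
      rcases ha.eq_or_lt with rfl | ha
      · obtain rfl : b = 1 := by linarith
        linarith
      · nlinarith [mul_neg_of_pos_of_neg ha hw, mul_nonpos_of_nonneg_of_nonpos hb hw'.le]
    simp only [Prod.fst_add, Prod.snd_add, Prod.smul_fst, Prod.smul_snd, smul_eq_mul]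
    linarith
  have hVc : Convex ℝ V := by
    intro w hw w' hw' a b ha hb hab q hq
    have h1 := mul_le_mul_of_nonneg_left (hw q hq) ha
    have h2 := mul_le_mul_of_nonneg_left (hw' q hq) hb
    obtain rfl : b = 1 - a := by linarith
    simp
    linarith
  have hdisj : Disjoint U V := by
    rw [Set.disjoint_left]
    rintro ⟨p, t⟩ hU hV
    simp only [U, V, mem_ofPred_eq] at hU hV
    have hpt : p.2 p.1 ≤ t := by
      by_contra! hlt
      have hpG : p ∈ G := hmax p fun q hq => by
        have := hV q hq
        simp
        linarith
      have := hV p hpG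
      linarith
    linarith [hpair p]
  obtain ⟨L, c, hLU, hLV⟩ := geometric_hahn_banach_open hUc hUo hVc hdisj
  let L₁ : StrongDual ℝ E :=
    L.comp ((ContinuousLinearMap.inl ℝ (E × StrongDual ℝ E) ℝ).comp
      (ContinuousLinearMap.inl ℝ E (StrongDual ℝ E)))
  let L₂ : StrongDual ℝ (StrongDual ℝ E) :=
    L.comp ((ContinuousLinearMap.inl ℝ (E × StrongDual ℝ E) ℝ).comp
      (ContinuousLinearMap.inr ℝ E (StrongDual ℝ E)))
  set s : ℝ := L (0, 1) with hs
  have hL : ∀ (y : E) (v : StrongDual ℝ E) (t : ℝ), L ((y, v), t) = L₁ y + L₂ v + s * t := by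
    intro y v t
    have : ((y, v), t) = ((y, (0 : StrongDual ℝ E)), (0 : ℝ)) + (((0 : E), v), (0 : ℝ)) +
        t • ((0 : E × StrongDual ℝ E), (1 : ℝ)) := by simp
    rw [this, map_add, map_add, map_smul, smul_eq_mul, mul_comm]
    rfl
  have hGV : ∀ q ∈ G, (q, q.2 q.1) ∈ V := fun q hq q' hq' => by
    have := hmono q hq q' hq'
    simp at this ⊢
    linarith
  -- The hyperplane is not vertical: the fibre over a point q of G meets both sets, with U below V.
  have hspos : 0 < s := by
    obtain ⟨q, hq⟩ := hne
    have h1 := hLV _ (hGV q hq)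
    set t := min (q.2 q.1) (-(‖q.1‖ ^ 2 / 2 + ‖q.2‖ ^ 2 / 2)) - 1 with ht
    have ht1 : t < q.2 q.1 := by
      linarith [min_le_left (q.2 q.1) (-(‖q.1‖ ^ 2 / 2 + ‖q.2‖ ^ 2 / 2))]
    have h2 := hLU (q, t) (by
      simp only [U, mem_ofPred_eq]
      linarith [min_le_right (q.2 q.1) (-(‖q.1‖ ^ 2 / 2 + ‖q.2‖ ^ 2 / 2))])
    rw [show q = (q.1, q.2) from rfl, hL] at h1 h2
    nlinarith
  obtain ⟨y, hy⟩ := hE (s⁻¹ • L₂)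
  set p : StrongDual ℝ E := s⁻¹ • L₁ with hp
  have hpL : ∀ w, L₁ w = s * p w := fun w => by simp [hp, hspos.ne']
  have hyL : ∀ v, L₂ v = s * v y := fun v => by
    have : v y = s⁻¹ * L₂ v := DFunLike.congr_fun hy v
    rw [this]
    field_simp
  have hupper : ∀ (w : E) (v : StrongDual ℝ E),
      p w + v y - (‖w‖ ^ 2 / 2 + ‖v‖ ^ 2 / 2) ≤ c / s := by
    intro w v
    refine le_of_forall_pos_le_add fun ε hε => ?_
    have := hLU ((w, v), -(‖w‖ ^ 2 / 2 + ‖v‖ ^ 2 / 2) - ε)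
      (by simp only [U, mem_ofPred_eq]; linarith)
    rw [hL, hpL, hyL, ← mul_add, ← mul_add, mul_comm, ← lt_div_iff₀ hspos] at this
    linarith
  have hcs : ‖p‖ ^ 2 / 2 + ‖y‖ ^ 2 / 2 ≤ c / s := by
    obtain ⟨g, hg, hgp⟩ := exists_dual_vector'' ℝ p
    obtain ⟨w, rfl⟩ := hE g
    have hw : ‖w‖ ≤ 1 :=
      ((NormedSpace.inclusionInDoubleDualLi (E := E) ℝ).norm_map w).symm.le.trans hg
    replace hgp : p w = ‖p‖ := hgp
    obtain ⟨v, hv, hvy⟩ := exists_dual_vector'' ℝ y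
    have := hupper (‖p‖ • w) (‖y‖ • v)
    simp only [map_smul, smul_eq_mul, hgp, smul_apply, hvy, norm_smul,
      norm_norm, RCLike.ofReal_real_eq_id, id_eq] at this
    have h1 : (‖p‖ * ‖w‖) ^ 2 ≤ ‖p‖ ^ 2 := by
      rw [mul_pow]; exact mul_le_of_le_one_right (by positivity) (pow_le_one₀ (norm_nonneg _) hw)
    have h2 : (‖y‖ * ‖v‖) ^ 2 ≤ ‖y‖ ^ 2 := by
      rw [mul_pow]; exact mul_le_of_le_one_right (by positivity) (pow_le_one₀ (norm_nonneg _) hv)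
    nlinarith
  have hlower : ∀ q ∈ G, c / s ≤ p q.1 + q.2 y + q.2 q.1 := by
    intro q hq
    have := hLV _ (hGV q hq)
    rw [show q = (q.1, q.2) from rfl, hL, hpL, hyL, ← mul_add, ← mul_add] at this
    rw [div_le_iff₀' hspos]
    exact this
  -- The separating functional, normalized to (p, y), gives a point monotonically related to all of
  -- G. Applying `hlower` to that very point then yields the conclusion.
  have hmem : (-y, -p) ∈ G := hmax _ fun q hq => by
    have h1 := hlower q hq
    have h2 := hpair (y, p)
    simp at h2 ⊢
    linarith
  refine ⟨_, hmem, ?_⟩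
  have := hlower _ hmem
  simp at this ⊢
  linarith

/-- In a reflexive space, weak sequential limits of points of the domain of a maximally monotone
operator belong to the closure of the domain. -/
theorem IsMaximallyMonotone.mem_closure_opDom (hE : IsReflexive E)
    {M : E → Set (StrongDual ℝ E)} (hM : IsMaximallyMonotone M) {y : ℕ → E} {x : E}
    (hy : ∀ n, y n ∈ opDom M) (hyx : WeakTendsto y x) : x ∈ closure (opDom M) := by
  by_contra hx
  obtain ⟨r, hr, hball⟩ : ∃ r > 0, ∀ w ∈ opDom M, r ≤ ‖w - x‖ := by
    rw [Metric.mem_closure_iff] at hx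
    push Not at hx
    obtain ⟨r, hr, h⟩ := hx
    exact ⟨r, hr, fun w hw => by simpa [dist_eq_norm, norm_sub_rev] using h w hw⟩
  -- Regularization: λM, translated by x, meets the graph of -J. The weak limit j of λv as λ → 0
  -- will satisfy r² ≤ j(x - z) on dom M, which is contradicted by z = y n ⇀ x.
  have hres : ∀ lam : ℝ, 0 < lam → ∃ w, ∃ v ∈ M w,
      (lam • v) (w - x) + ‖w - x‖ ^ 2 / 2 + ‖lam • v‖ ^ 2 / 2 ≤ 0 := by
    intro lam hlam
    obtain ⟨v₀, hv₀⟩ := hy 0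
    obtain ⟨⟨w, u⟩, ⟨v, hv, rfl⟩, h⟩ := exists_mem_graph_neg_duality hE
      (G := {p | ∃ v ∈ M (p.1 + x), p.2 = lam • v})
      ⟨(y 0 - x, lam • v₀), v₀, by simpa using hv₀, rfl⟩
      (by
        rintro ⟨p₁, p₂⟩ ⟨v, hv, rfl⟩ ⟨q₁, q₂⟩ ⟨v', hv', rfl⟩
        have := hM.1 _ _ _ hv _ hv'
        rw [add_sub_add_right_eq_sub] at this
        refine (mul_nonneg hlam.le this).trans_eq ?_
        simp only [sub_apply, smul_apply, smul_eq_mul, mul_sub])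
      (by
        rintro ⟨p₁, p₂⟩ h
        refine ⟨lam⁻¹ • p₂, hM.mem_of_forall fun z v hv => ?_, by simp [smul_smul, hlam.ne']⟩
        have := h (z - x, lam • v) ⟨v, by simpa using hv, rfl⟩
        have h2 : (lam⁻¹ • p₂ - v) (p₁ + x - z) = lam⁻¹ * (p₂ - lam • v) (p₁ - (z - x)) := by
          rw [show p₁ - (z - x) = p₁ + x - z by abel]
          simp only [sub_apply, smul_apply, smul_eq_mul]
          field_simp
        rw [h2]
        exact mul_nonneg (inv_pos.2 hlam).le this)
    exact ⟨w + x, v, hv, by simpa using h⟩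
  let lam : ℕ → ℝ := fun n => 1 / ((n : ℝ) + 1)
  have hlam : ∀ n, 0 < lam n := fun n => by positivity
  have hlam1 : ∀ n, lam n ≤ 1 := fun n => by
    rw [div_le_one (by positivity)]; simp
  choose w v hv hwv using fun n => hres (lam n) (hlam n)
  have hnorm : ∀ n, ‖lam n • v n‖ = ‖w n - x‖ := fun n => by
    have h1 := (lam n • v n).le_opNorm (w n - x)
    have h2 := neg_abs_le ((lam n • v n) (w n - x))
    rw [Real.norm_eq_abs] at h1
    have h3 : (‖lam n • v n‖ - ‖w n - x‖) ^ 2 ≤ 0 := by nlinarith [hwv n]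
    exact sub_eq_zero.1 (pow_eq_zero_iff (two_ne_zero) |>.1 (le_antisymm h3 (sq_nonneg _)))
  -- Monotonicity between (w n, v n) and (z, a), scaled by λ, combined with the relation defining
  -- -J.
  have hmain : ∀ n (z : E) (a : StrongDual ℝ E), a ∈ M z →
      ‖w n - x‖ ^ 2 ≤ (lam n • v n) (x - z) - lam n * a (w n - z) := by
    intro n z a ha
    have h1 := mul_nonneg (hlam n).le (hM.1 _ _ _ (hv n) _ ha)
    have h2 := hwv n
    rw [hnorm n] at h2
    have h3 : (lam n • v n) (w n - x) = lam n * v n (w n - z) - (lam n • v n) (x - z) := by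
      simp; ring
    rw [sub_apply, mul_sub] at h1
    linarith
  obtain ⟨a₀, ha₀⟩ := hy 0
  set R := ‖x - y 0‖
  have hbdd : ∀ n, ‖w n - x‖ ≤ R + ‖a₀‖ + ‖a₀‖ * R + 1 := by
    intro n
    have h1 := hmain n _ a₀ ha₀
    have h2 : (lam n • v n) (x - y 0) ≤ ‖w n - x‖ * R :=
      (le_abs_self _).trans (((lam n • v n).le_opNorm _).trans_eq (by rw [hnorm n]))
    have h3 : -(lam n * a₀ (w n - y 0)) ≤ ‖a₀‖ * (‖w n - x‖ + R) := by
      have h4 : |a₀ (w n - y 0)| ≤ ‖a₀‖ * (‖w n - x‖ + R) :=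
        (a₀.le_opNorm _).trans (by
          gcongr
          simpa using norm_add_le (w n - x) (x - y 0))
      have h5 := neg_abs_le (a₀ (w n - y 0))
      have h6 : lam n * |a₀ (w n - y 0)| ≤ |a₀ (w n - y 0)| :=
        mul_le_of_le_one_left (abs_nonneg _) (hlam1 n)
      nlinarith [hlam n]
    by_contra! hcon
    have hR : 0 ≤ R := norm_nonneg _
    have ha : 0 ≤ ‖a₀‖ := norm_nonneg _
    have hd : 1 ≤ ‖w n - x‖ := by nlinarith [mul_nonneg ha hR]
    nlinarith [mul_nonneg ha hR, mul_le_mul_of_nonneg_left hd (mul_nonneg ha hR)]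
  obtain ⟨j, k, hk, hj⟩ := hE.exists_weakTendsto_subseq (u := fun n => lam n • v n)
    (fun n => (hnorm n).le.trans (hbdd n))
  have hjle : ∀ z ∈ opDom M, r ^ 2 ≤ j (x - z) := by
    rintro z ⟨a, ha⟩
    have h1 : Tendsto (fun n => (lam (k n) • v (k n)) (x - z)) atTop (𝓝 (j (x - z))) :=
      weakTendsto_iff.1 hj (NormedSpace.inclusionInDoubleDual ℝ E (x - z))
    have h2 : Tendsto (fun n => lam n * a (w n - z)) atTop (𝓝 0) := by
      refine tendsto_one_div_add_atTop_nhds_zero_nat.zero_mul_isBoundedUnder_le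
        (isBoundedUnder_of ⟨‖a‖ * (R + ‖a₀‖ + ‖a₀‖ * R + 1 + ‖x - z‖), fun n => ?_⟩)
      refine (a.le_opNorm _).trans ?_
      gcongr
      refine le_trans ?_ (add_le_add_left (hbdd n) _)
      simpa using norm_add_le (w n - x) (x - z)
    have h3 := h1.sub (h2.comp hk.tendsto_atTop)
    rw [sub_zero] at h3
    refine ge_of_tendsto' h3 fun n => ?_
    refine le_trans ?_ (hmain (k n) z a ha)
    have := hball (w (k n)) ⟨_, hv (k n)⟩
    gcongr
  have h1 : Tendsto (fun n => j (x - y n)) atTop (𝓝 0) := by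
    have := (weakTendsto_iff.1 hyx j).const_sub (j x)
    simpa using this
  have h2 : r ^ 2 ≤ 0 := ge_of_tendsto' h1 fun n => hjle _ (hy n)
  exact absurd h2 (not_le.2 (by positivity))

end MaximallyMonotone

/-! ### Convex functions: continuity, subgradients, gradients. -/

section ConvexFunctions

variable {E : Type*} [NormedAddCommGroup E] [NormedSpace ℝ E] {g : E → EReal}

theorem IsGamma0.coe_toReal (hg : IsGamma0 g) {x : E} (hx : x ∈ effDom g) :
    ((g x).toReal : EReal) = g x :=
  EReal.coe_toReal (ne_of_lt hx) (hg.ne_bot x)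

theorem IsGamma0.le_combo (hg : IsGamma0 g) {x y : E} (hx : x ∈ effDom g) (hy : y ∈ effDom g)
    {a b : ℝ} (ha : 0 ≤ a) (hb : 0 ≤ b) (hab : a + b = 1) :
    g (a • x + b • y) ≤ ((a * (g x).toReal + b * (g y).toReal : ℝ) : EReal) := by
  rcases ha.eq_or_lt with rfl | ha
  · obtain rfl : b = 1 := by linarith
    simp [hg.coe_toReal hy]
  rcases hb.eq_or_lt with rfl | hb
  · obtain rfl : a = 1 := by linarith
    simp [hg.coe_toReal hx]
  rw [EReal.coe_add, EReal.coe_mul, EReal.coe_mul, hg.coe_toReal hx, hg.coe_toReal hy]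
  exact hg.convex x y a b ha hb hab

theorem IsGamma0.convex_effDom (hg : IsGamma0 g) : Convex ℝ (effDom g) :=
  fun _ hx _ hy _ _ ha hb hab => (hg.le_combo hx hy ha hb hab).trans_lt (EReal.coe_lt_top _)

theorem IsGamma0.convexOn_toReal (hg : IsGamma0 g) :
    ConvexOn ℝ (effDom g) fun x => (g x).toReal :=
  ⟨hg.convex_effDom, fun x hx y hy a b ha hb hab => by
    have h := hg.le_combo hx hy ha hb hab
    rw [← hg.coe_toReal (hg.convex_effDom hx hy ha hb hab)] at h
    exact EReal.coe_le_coe_iff.1 h⟩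

theorem IsGamma0.convexOn_interior (hg : IsGamma0 g) :
    ConvexOn ℝ (interior (effDom g)) fun x => (g x).toReal :=
  hg.convexOn_toReal.subset interior_subset hg.convex_effDom.interior

theorem IsGamma0.convex_sublevel (hg : IsGamma0 g) (c : ℝ) : Convex ℝ {x | g x ≤ c} := by
  have hdom : ∀ x, g x ≤ c → x ∈ effDom g := fun x h => h.trans_lt (EReal.coe_lt_top c)
  intro x hx y hy a b ha hb hab
  refine (hg.le_combo (hdom x hx) (hdom y hy) ha hb hab).trans (EReal.coe_le_coe_iff.2 ?_)
  have h1 : (g x).toReal ≤ c := by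
    rw [← EReal.coe_le_coe_iff, hg.coe_toReal (hdom x hx)]; exact hx
  have h2 : (g y).toReal ≤ c := by
    rw [← EReal.coe_le_coe_iff, hg.coe_toReal (hdom y hy)]; exact hy
  obtain rfl : b = 1 - a := by linarith
  nlinarith

theorem IsGamma0.isClosed_sublevel (hg : IsGamma0 g) (c : EReal) : IsClosed {x | g x ≤ c} :=
  hg.lsc.isClosed_preimage c

/-- A lower semicontinuous convex function on a Banach space is continuous on the interior of its
domain. -/
theorem IsGamma0.continuousOn_interior [CompleteSpace E] (hg : IsGamma0 g) :
    ContinuousOn (fun x => (g x).toReal) (interior (effDom g)) := by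
  rcases (interior (effDom g)).eq_empty_or_nonempty with h | hne
  · rw [h]; exact continuousOn_empty _
  refine ((hg.convexOn_interior.continuousOn_tfae isOpen_interior hne).out 1 3).2 ?_
  -- Baire category: some sublevel set has interior inside int dom g, so g is bounded above near one
  -- point, which suffices for a convex function.
  have hclosed : ∀ n : ℕ, IsClosed ({x | g x ≤ ((n : ℝ) : EReal)} ∪ (interior (effDom g))ᶜ) :=
    fun n => (hg.isClosed_sublevel _).union isOpen_interior.isClosed_compl
  have hcover : ⋃ n : ℕ, ({x | g x ≤ ((n : ℝ) : EReal)} ∪ (interior (effDom g))ᶜ) = univ := by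
    refine eq_univ_of_forall fun x => mem_iUnion.2 ?_
    by_cases hx : x ∈ interior (effDom g)
    · obtain ⟨n, hn⟩ := exists_nat_ge (g x).toReal
      refine ⟨n, Or.inl ?_⟩
      rw [mem_ofPred_eq, ← hg.coe_toReal (interior_subset hx)]
      exact EReal.coe_le_coe_iff.2 hn
    · exact ⟨0, Or.inr hx⟩
  obtain ⟨x, hx, hxU⟩ := (dense_iUnion_interior_of_closed hclosed hcover).inter_open_nonempty _
    isOpen_interior hne
  obtain ⟨n, hn⟩ := mem_iUnion.1 hxU
  refine ⟨x, hx, (n : ℝ), ?_⟩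
  rw [eventually_map]
  filter_upwards [isOpen_interior.mem_nhds hx, isOpen_interior.mem_nhds hn] with y hy hyn
  have h1 := (interior_subset hyn).resolve_right (fun h => h hy)
  rw [mem_ofPred_eq, ← hg.coe_toReal (interior_subset hy)] at h1
  exact EReal.coe_le_coe_iff.1 h1

theorem IsGamma0.mem_effDom_of_mem_subdiff (hg : IsGamma0 g) {x : E} {u : StrongDual ℝ E}
    (hu : u ∈ subdiff g x) : x ∈ effDom g := by
  obtain ⟨y, hy⟩ := hg.nonempty
  by_contra hx
  have hx' : g x = ⊤ := not_lt_top_iff.1 hx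
  have := hu y
  rw [hx', EReal.coe_add_top] at this
  exact (this.trans_lt hy).ne rfl

theorem IsGamma0.mem_subdiff_iff (hg : IsGamma0 g) {x : E} (hx : x ∈ effDom g)
    {u : StrongDual ℝ E} :
    u ∈ subdiff g x ↔ ∀ y ∈ effDom g, u (y - x) + (g x).toReal ≤ (g y).toReal := by
  constructor
  · intro h y hy
    have := h y
    rw [← hg.coe_toReal hx, ← hg.coe_toReal hy] at this
    exact_mod_cast this
  · intro h y
    by_cases hy : y ∈ effDom g
    · rw [← hg.coe_toReal hx, ← hg.coe_toReal hy]
      exact_mod_cast h y hy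
    · rw [show g y = ⊤ from not_lt_top_iff.1 hy]
      exact le_top

/-- Every lower bound `p` for the directional derivative at an interior point `x` of the domain
is dominated by a subgradient. -/
theorem IsGamma0.exists_subgradient_ge [CompleteSpace E] (hg : IsGamma0 g) {x v : E} {p : ℝ}
    (hx : x ∈ interior (effDom g))
    (hp : ∀ t : ℝ, 0 < t → x + t • v ∈ effDom g →
      (g x).toReal + t * p ≤ (g (x + t • v)).toReal) :
    ∃ u ∈ subdiff g x, p ≤ u v := by
  set G : E → ℝ := fun y => (g y).toReal with hG
  -- The strict epigraph over the interior is separated from the ray of slope p issued from (x, g x)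
  -- in direction v. The rescaled separating functional is the subgradient.
  let U : Set (E × ℝ) := {w | w.1 ∈ interior (effDom g) ∧ G w.1 < w.2}
  let V : Set (E × ℝ) := {w | ∃ t : ℝ, 0 ≤ t ∧ w = (x + t • v, G x + t * p)}
  have hUc : Convex ℝ U := hg.convexOn_interior.convex_strict_epigraph
  have hUo : IsOpen U := by
    have hcont : ContinuousOn (fun w : E × ℝ => w.2 - G w.1) (interior (effDom g) ×ˢ univ) :=
      continuousOn_snd.sub
        (hg.continuousOn_interior.comp continuousOn_fst fun w hw => hw.1)
    have := hcont.isOpen_inter_preimage (isOpen_interior.prod isOpen_univ) (isOpen_Ioi (a := 0))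
    convert this using 1
    ext w
    simp [U]
  have hVc : Convex ℝ V := by
    rintro _ ⟨t, ht, rfl⟩ _ ⟨t', ht', rfl⟩ a b ha hb hab
    refine ⟨a * t + b * t', by positivity, ?_⟩
    obtain rfl : b = 1 - a := by linarith
    ext
    · simp only [Prod.smul_mk, Prod.mk_add_mk]
      module
    · simp only [Prod.smul_mk, Prod.mk_add_mk, smul_eq_mul]
      ring
  have hdisj : Disjoint U V := by
    rw [Set.disjoint_left]
    rintro _ ⟨hU1, hU2⟩ ⟨t, ht, rfl⟩
    rcases ht.eq_or_lt with rfl | ht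
    · simp at hU2
    · exact hU2.not_ge (hp t ht (interior_subset hU1))
  obtain ⟨L, c, hLU, hLV⟩ := geometric_hahn_banach_open hUc hUo hVc hdisj
  let L₁ : StrongDual ℝ E := L.comp (ContinuousLinearMap.inl ℝ E ℝ)
  set s : ℝ := L (0, 1) with hs
  have hL : ∀ (y : E) (t : ℝ), L (y, t) = L₁ y + s * t := by
    intro y t
    have : (y, t) = (y, (0 : ℝ)) + t • ((0 : E), (1 : ℝ)) := by simp
    rw [this, map_add, map_smul, smul_eq_mul, mul_comm]
    rfl
  have hVx : c ≤ L₁ x + s * G x := by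
    rw [← hL]
    exact hLV _ ⟨0, le_rfl, by simp⟩
  have hUlt : ∀ y ∈ interior (effDom g), ∀ r, G y < r → L₁ y + s * r < c := fun y hy r hr => by
    rw [← hL]
    exact hLU (y, r) ⟨hy, hr⟩
  have hsneg : s < 0 := by
    have := hUlt x hx (G x + 1) (by linarith)
    linarith
  have hUle : ∀ y ∈ interior (effDom g), L₁ y + s * G y ≤ c := fun y hy => by
    refine le_of_forall_pos_le_add fun ε hε => ?_
    have := hUlt y hy (G y + ε / (-s)) (by
      have : 0 < ε / (-s) := div_pos hε (by linarith)
      linarith)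
    have h2 : s * (ε / (-s)) = -ε := by
      have := hsneg.ne
      field_simp
    rw [mul_add, h2] at this
    linarith
  set u : StrongDual ℝ E := (-s)⁻¹ • L₁ with hu
  have huL : ∀ y, L₁ y = (-s) * u y := fun y => by simp [hu, hsneg.ne]
  have hint : ∀ y ∈ interior (effDom g), u (y - x) + G x ≤ G y := fun y hy => by
    have h1 := hUle y hy
    rw [huL] at h1 hVx
    rw [map_sub]
    nlinarith
  refine ⟨u, (hg.mem_subdiff_iff (interior_subset hx)).2 fun y hy => ?_, ?_⟩
  -- The midpoint of x and any point of the domain is interior, which carries the inequality from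
  -- the interior to the whole domain.
  · have hmem : (1 / 2 : ℝ) • x + (1 / 2 : ℝ) • y ∈ interior (effDom g) :=
      hg.convex_effDom.combo_interior_self_mem_interior hx hy (by norm_num) (by norm_num)
        (by norm_num)
    have h1 := hint _ hmem
    have h2 := hg.convexOn_toReal.2 (interior_subset hx) hy
      (show (0 : ℝ) ≤ 1 / 2 by norm_num) (show (0 : ℝ) ≤ 1 / 2 by norm_num) (by norm_num)
    rw [show (1 / 2 : ℝ) • x + (1 / 2 : ℝ) • y - x = (1 / 2 : ℝ) • (y - x) by module, map_smul]
      at h1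
    simp only [smul_eq_mul] at h1 h2
    linarith
  · have h1 := hLV _ ⟨1, zero_le_one, rfl⟩
    rw [hL, huL, one_smul, map_add] at h1
    have h2 := hUle x hx
    rw [huL] at h2
    nlinarith

theorem IsGamma0.nonempty_subdiff [CompleteSpace E] (hg : IsGamma0 g) {x : E}
    (hx : x ∈ interior (effDom g)) : (subdiff g x).Nonempty := by
  obtain ⟨u, hu, -⟩ := hg.exists_subgradient_ge (v := 0) (p := 0) hx (by simp)
  exact ⟨u, hu⟩

/-- A lower semicontinuous convex function with at most one subgradient at an interior point of its
domain is Gâteaux differentiable there. -/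
theorem IsGamma0.hasGateauxGradAt_of_subdiff_subset [CompleteSpace E] (hg : IsGamma0 g) {x : E}
    {u : StrongDual ℝ E} (hx : x ∈ interior (effDom g)) (hu : subdiff g x ⊆ {u}) :
    HasGateauxGradAt g u x := by
  refine ⟨hx, fun v => ?_⟩
  set φ : ℝ → ℝ := fun t => (g (x + t • v)).toReal with hφ
  let T : ℝ →ᵃ[ℝ] E := AffineMap.lineMap x (x + v)
  have hT : ∀ t, T t = x + t • v := fun t => by simp [T, AffineMap.lineMap_apply, add_comm]
  have hconv : ConvexOn ℝ (T ⁻¹' effDom g) φ := by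
    have := hg.convexOn_toReal.comp_affineMap T
    have hcomp : (fun y => (g y).toReal) ∘ T = φ := funext fun t => by
      simp only [Function.comp_apply, hT, hφ]
    rwa [hcomp] at this
  have h0 : (0 : ℝ) ∈ interior (T ⁻¹' effDom g) := by
    have hTc : Continuous T := by
      have : (T : ℝ → E) = fun t => x + t • v := funext hT
      rw [this]; fun_prop
    refine preimage_interior_subset_interior_preimage hTc ?_
    simpa [hT] using hx
  set p := derivWithin φ (Ioi 0) 0
  set q := derivWithin φ (Iio 0) 0
  have hqp : q ≤ p := hconv.leftDeriv_le_rightDeriv_of_mem_interior h0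
  -- Each one-sided derivative is dominated by some subgradient, necessarily u; with q ≤ p this
  -- forces q = p = u v.
  have hp : p ≤ u v := by
    obtain ⟨u', hu', h⟩ := hg.exists_subgradient_ge (v := v) (p := p) hx fun t ht hmem => by
      have h1 := hconv.rightDeriv_le_slope_of_mem_interior h0 (y := t)
        (by rw [mem_preimage, hT]; exact hmem) ht
      rw [slope_def_field, le_div_iff₀ (by linarith)] at h1
      simp only [hφ, zero_smul, add_zero, sub_zero] at h1
      linarith
    rwa [← hu hu']
  have hq : u v ≤ q := by
    obtain ⟨u', hu', h⟩ := hg.exists_subgradient_ge (v := -v) (p := -q) hx fun t ht hmem => by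
      have hneg : x + t • -v = x + (-t) • v := by simp
      rw [hneg] at hmem ⊢
      have h1 := hconv.slope_le_leftDeriv_of_mem_interior (x := -t)
        (by rw [mem_preimage, hT]; exact hmem) h0 (by linarith)
      rw [slope_def_field, div_le_iff₀ (by linarith)] at h1
      simp only [hφ, zero_smul, add_zero, zero_sub, neg_neg] at h1
      linarith
    rw [hu hu', map_neg] at h
    linarith
  have hpe : p = u v := le_antisymm hp (hq.trans hqp)
  have hqe : q = u v := le_antisymm (hqp.trans hp) hq
  have hright := hconv.hasDerivWithinAt_rightDeriv_of_mem_interior h0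
  have hleft := hconv.hasDerivWithinAt_leftDeriv_of_mem_interior h0
  change HasDerivWithinAt φ p (Ioi 0) 0 at hright
  change HasDerivWithinAt φ q (Iio 0) 0 at hleft
  rw [hpe, hasDerivWithinAt_Ioi_iff_Ici] at hright
  rw [hqe, hasDerivWithinAt_Iio_iff_Iic] at hleft
  have := hleft.union hright
  rw [Iic_union_Ici, hasDerivWithinAt_univ] at this
  exact this

theorem HasGateauxGradAt.eq {x : E} {u v : StrongDual ℝ E} (hu : HasGateauxGradAt g u x)
    (hv : HasGateauxGradAt g v x) : u = v :=
  ContinuousLinearMap.ext fun w => HasDerivAt.unique (hu.2 w) (hv.2 w)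

theorem HasGateauxGradAt.grad_eq {x : E} {u : StrongDual ℝ E} (hu : HasGateauxGradAt g u x) :
    grad g x = u := by
  have h : ∃ u, HasGateauxGradAt g u x := ⟨u, hu⟩
  rw [grad, dif_pos h]
  exact h.choose_spec.eq hu

theorem IsGamma0.bregman_eq (hg : IsGamma0 g) {x y : E} (hx : x ∈ effDom g)
    (hy : y ∈ interior (effDom g)) :
    bregman g x y = (((g x).toReal - (g y).toReal - grad g y (x - y) : ℝ) : EReal) := by
  rw [bregman, if_pos hy, EReal.coe_sub, EReal.coe_sub, hg.coe_toReal hx,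
    hg.coe_toReal (interior_subset hy)]

theorem EssentiallySmooth.subdiff_eq [CompleteSpace E] (hs : EssentiallySmooth g)
    (hg : IsGamma0 g) {x : E} (hx : x ∈ interior (effDom g)) : subdiff g x = {grad g x} := by
  obtain ⟨u, hu⟩ := hs.2 x (hg.nonempty_subdiff hx)
  rw [(hg.hasGateauxGradAt_of_subdiff_subset hx hu.le).grad_eq, hu]

theorem EssentiallySmooth.grad_mem_subdiff [CompleteSpace E] (hs : EssentiallySmooth g)
    (hg : IsGamma0 g) {x : E} (hx : x ∈ interior (effDom g)) : grad g x ∈ subdiff g x := by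
  rw [hs.subdiff_eq hg hx]
  exact mem_singleton _

/-- The gradient inequality, which says that the Bregman distance is nonnegative. -/
theorem EssentiallySmooth.grad_le [CompleteSpace E] (hs : EssentiallySmooth g)
    (hg : IsGamma0 g) {x y : E} (hx : x ∈ interior (effDom g)) (hy : y ∈ effDom g) :
    grad g x (y - x) + (g x).toReal ≤ (g y).toReal :=
  (hg.mem_subdiff_iff (interior_subset hx)).1 (hs.grad_mem_subdiff hg hx) y hy

/-- At a boundary point of the domain a nonzero supporting functional exists. Adding it to a
subgradient gives a second one, against single-valuedness. -/
theorem EssentiallySmooth.opDom_subdiff_subset (hs : EssentiallySmooth g) (hg : IsGamma0 g)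
    (hne : (interior (effDom g)).Nonempty) : opDom (subdiff g) ⊆ interior (effDom g) := by
  intro x hx
  by_contra hxi
  obtain ⟨N, hN0, hN⟩ :=
    geometric_hahn_banach_of_nonempty_interior_point hg.convex_effDom hxi hne
  obtain ⟨u, hu⟩ := hs.2 x hx
  have hux : u ∈ subdiff g x := hu ▸ mem_singleton u
  have hxd := hg.mem_effDom_of_mem_subdiff hux
  have huN : u + N ∈ subdiff g x := (hg.mem_subdiff_iff hxd).2 fun y hy => by
    have h1 := (hg.mem_subdiff_iff hxd).1 hux y hy
    have h2 := hN y hy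
    rw [add_apply, map_sub N]
    linarith
  rw [hu, mem_singleton_iff, add_eq_left] at huN
  exact hN0 huN

/-- The gradients of `g` are bounded at the points whose Bregman distance to a given interior point
is bounded. -/
theorem EssentiallySmooth.exists_norm_grad_le [CompleteSpace E] (hs : EssentiallySmooth g)
    (hg : IsGamma0 g) {z : E} (hz : z ∈ interior (effDom g)) (K : ℝ) :
    ∃ R, ∀ y ∈ interior (effDom g),
      (g z).toReal - (g y).toReal - grad g y (z - y) ≤ K → ‖grad g y‖ ≤ R := by
  have hcont := hg.continuousOn_interior.continuousAt (isOpen_interior.mem_nhds hz)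
  have hev : ∀ᶠ w in 𝓝 z, w ∈ interior (effDom g) ∧ (g w).toReal < (g z).toReal + 1 :=
    (isOpen_interior.eventually_mem hz).and (hcont.eventually_lt_const (lt_add_one _))
  obtain ⟨r, hr, hball⟩ := Metric.eventually_nhds_iff.1 hev
  refine ⟨(K + 1) / (r / 2), fun y hy hK => ?_⟩
  -- The gradient inequality at y is tested at z + h, where g is less than g z + 1.
  have hle : ∀ h : E, ‖h‖ < r → grad g y h ≤ K + 1 := fun h hh => by
    obtain ⟨h1, h2⟩ := hball (y := z + h) (by simpa using hh)
    have h3 := hs.grad_le hg hy (interior_subset h1)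
    rw [show z + h - y = (z - y) + h by abel, map_add] at h3
    linarith
  have hK1 : 0 ≤ K + 1 := by simpa using hle 0 (by simpa using hr)
  refine ContinuousLinearMap.opNorm_le_bound _ (by positivity) fun h => ?_
  rcases eq_or_ne h 0 with rfl | hne
  · simp
  have hn : 0 < ‖h‖ := norm_pos_iff.2 hne
  have hscale : ∀ h' : E, ‖h'‖ = ‖h‖ → grad g y h' ≤ (K + 1) / (r / 2) * ‖h‖ := fun h' hh' => by
    have h1 := hle ((r / 2 / ‖h‖) • h') (by
      rw [norm_smul, hh', Real.norm_of_nonneg (by positivity), div_mul_cancel₀ _ hn.ne']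
      linarith)
    rw [map_smul, smul_eq_mul] at h1
    rw [div_mul_eq_mul_div, le_div_iff₀ (by positivity)]
    rw [div_mul_eq_mul_div, div_le_iff₀ hn] at h1
    linarith
  rw [Real.norm_eq_abs, abs_le]
  have h2 := hscale (-h) (norm_neg h)
  rw [map_neg] at h2
  exact ⟨by linarith, hscale h rfl⟩

/-- A strong limit of interior points at which the gradients of an essentially smooth function stay
bounded is an interior point. -/
theorem EssentiallySmooth.mem_interior_of_tendsto [CompleteSpace E] (hE : IsReflexive E)
    (hs : EssentiallySmooth g) (hg : IsGamma0 g) {y : ℕ → E} {x : E} {R : ℝ}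
    (hy : ∀ n, y n ∈ interior (effDom g)) (hR : ∀ n, ‖grad g (y n)‖ ≤ R)
    (hyx : Tendsto y atTop (𝓝 x)) : x ∈ interior (effDom g) := by
  obtain ⟨u, k, hk, hu⟩ := hE.exists_weakTendsto_subseq hR
  refine hs.opDom_subdiff_subset hg ⟨y 0, hy 0⟩ ⟨u, ?_⟩
  have hlim : ∀ w, Tendsto (fun n => grad g (y (k n)) (w - y (k n))) atTop (𝓝 (u (w - x))) := by
    intro w
    have h1 : Tendsto (fun n => grad g (y (k n)) (w - x)) atTop (𝓝 (u (w - x))) :=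
      weakTendsto_iff.1 hu (NormedSpace.inclusionInDoubleDual ℝ E (w - x))
    have h2 : Tendsto (fun n => grad g (y (k n)) (x - y (k n))) atTop (𝓝 0) := by
      have h3 : Tendsto (fun n => R * ‖x - y (k n)‖) atTop (𝓝 0) := by
        have := ((hyx.comp hk.tendsto_atTop).const_sub x).norm.const_mul R
        simpa using this
      exact squeeze_zero_norm (fun n => (grad g (y (k n))).le_of_opNorm_le (hR _) _) h3
    have h3 := h1.add h2
    simp only [← map_add, sub_add_sub_cancel, add_zero] at h3
    exact h3
  -- Closedness of sublevel sets is used for every c above the right-hand side, since g x is not yet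
  -- known to be finite.
  have hle : ∀ w ∈ effDom g, g x ≤ (((g w).toReal - u (w - x) : ℝ) : EReal) := by
    intro w hw
    refine EReal.le_of_forall_lt_iff_le.1 fun c hc => ?_
    have hc' : (g w).toReal - u (w - x) < c := EReal.coe_lt_coe_iff.1 hc
    have hev := ((hlim w).const_sub (g w).toReal).eventually_lt_const hc'
    refine (hg.isClosed_sublevel c).mem_of_tendsto (hyx.comp hk.tendsto_atTop) ?_
    filter_upwards [hev] with n hn
    have h1 := hs.grad_le hg (hy (k n)) hw
    show g (y (k n)) ≤ c
    rw [← hg.coe_toReal (interior_subset (hy (k n)))]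
    exact EReal.coe_le_coe_iff.2 (by linarith)
  obtain ⟨w₀, hw₀⟩ := hg.nonempty
  have hx : x ∈ effDom g := (hle w₀ hw₀).trans_lt (EReal.coe_lt_top _)
  refine (hg.mem_subdiff_iff hx).2 fun w hw => ?_
  have := hle w hw
  rw [← hg.coe_toReal hx, EReal.coe_le_coe_iff] at this
  linarith

end ConvexFunctions

/-! ### Conjugates and inversion of the subdifferential. -/

section Conjugate

variable {E : Type*} [NormedAddCommGroup E] [NormedSpace ℝ E] {f : E → EReal}

theorem IsGamma0.conjugate_le_iff (hf : IsGamma0 f) {u : StrongDual ℝ E} {c : ℝ} :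
    conjugate f u ≤ c ↔ ∀ y ∈ effDom f, u y - (f y).toReal ≤ c := by
  rw [conjugate, iSup_le_iff]
  refine forall_congr' fun y => ?_
  by_cases hy : y ∈ effDom f
  · rw [← hf.coe_toReal hy, ← EReal.coe_sub, EReal.coe_le_coe_iff]
    simp [hy]
  · rw [show f y = ⊤ from not_lt_top_iff.1 hy]
    simp [hy]

theorem IsGamma0.coe_le_conjugate (hf : IsGamma0 f) (u : StrongDual ℝ E) {y : E}
    (hy : y ∈ effDom f) : ((u y - (f y).toReal : ℝ) : EReal) ≤ conjugate f u := by
  rw [EReal.coe_sub, hf.coe_toReal hy]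
  exact le_iSup (fun y => ((u y : ℝ) : EReal) - f y) y

theorem IsGamma0.isGamma0_conjugate (hf : IsGamma0 f) (hne : (effDom (conjugate f)).Nonempty) :
    IsGamma0 (conjugate f) where
  ne_bot u := by
    obtain ⟨y, hy⟩ := hf.nonempty
    exact ((EReal.bot_lt_coe _).trans_le (hf.coe_le_conjugate u hy)).ne'
  nonempty := hne
  lsc := by
    refine lowerSemicontinuous_iSup fun y => Continuous.lowerSemicontinuous ?_
    by_cases hy : y ∈ effDom f
    · have : (fun u : StrongDual ℝ E => ((u y : ℝ) : EReal) - f y) =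
          fun u => ((u y - (f y).toReal : ℝ) : EReal) := by
        funext u
        rw [EReal.coe_sub, hf.coe_toReal hy]
      rw [this]
      exact continuous_coe_real_ereal.comp
        ((NormedSpace.inclusionInDoubleDual ℝ E y).continuous.sub continuous_const)
    · rw [show f y = ⊤ from not_lt_top_iff.1 hy]
      simpa using continuous_const
  convex u v a b ha hb hab := by
    refine iSup_le fun y => ?_
    by_cases hy : y ∈ effDom f
    · have h1 := mul_le_mul_of_nonneg_left (hf.coe_le_conjugate u hy)
        (EReal.coe_nonneg.2 ha.le)
      have h2 := mul_le_mul_of_nonneg_left (hf.coe_le_conjugate v hy)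
        (EReal.coe_nonneg.2 hb.le)
      refine le_trans (le_of_eq ?_) (add_le_add h1 h2)
      rw [← hf.coe_toReal hy, ← EReal.coe_sub, ← EReal.coe_mul, ← EReal.coe_mul, ← EReal.coe_add]
      congr 1
      obtain rfl : b = 1 - a := by linarith
      simp
      ring
    · rw [show f y = ⊤ from not_lt_top_iff.1 hy]
      simp

theorem IsGamma0.conjugate_eq_of_mem_subdiff (hf : IsGamma0 f) {x : E} {u : StrongDual ℝ E}
    (hu : u ∈ subdiff f x) : conjugate f u = ((u x - (f x).toReal : ℝ) : EReal) := by
  have hx := hf.mem_effDom_of_mem_subdiff hu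
  refine le_antisymm (hf.conjugate_le_iff.2 fun y hy => ?_) (hf.coe_le_conjugate u hx)
  have := (hf.mem_subdiff_iff hx).1 hu y hy
  rw [map_sub] at this
  linarith

theorem IsGamma0.mem_effDom_conjugate (hf : IsGamma0 f) {x : E} {u : StrongDual ℝ E}
    (hu : u ∈ subdiff f x) : u ∈ effDom (conjugate f) := by
  show conjugate f u < ⊤
  rw [hf.conjugate_eq_of_mem_subdiff hu]
  exact EReal.coe_lt_top _

/-- The biconjugate of `f` dominates `f`. -/
theorem IsGamma0.exists_conjugate_le_of_lt (hf : IsGamma0 f)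
    (hne : (effDom (conjugate f)).Nonempty) {x : E} {r : ℝ} (hr : (r : EReal) < f x) :
    ∃ (u : StrongDual ℝ E) (c : ℝ), conjugate f u ≤ c ∧ r < u x - c := by
  let S : Set (E × ℝ) := {w | f w.1 ≤ (w.2 : EReal)}
  have hSclosed : IsClosed S :=
    hf.lsc.isClosed_epigraph.preimage
      (continuous_fst.prodMk (continuous_coe_real_ereal.comp continuous_snd))
  have hdom : ∀ w ∈ S, w.1 ∈ effDom f := fun w hw => lt_of_le_of_lt hw (EReal.coe_lt_top _)
  have hmem : ∀ y ∈ effDom f, ∀ t, (f y).toReal ≤ t → (y, t) ∈ S := fun y hy t ht => by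
    show f y ≤ (t : EReal)
    rw [← hf.coe_toReal hy]
    exact EReal.coe_le_coe_iff.2 ht
  have hSconv : Convex ℝ S := by
    intro w hw w' hw' a b ha hb hab
    refine (hf.le_combo (hdom w hw) (hdom w' hw') ha hb hab).trans (EReal.coe_le_coe_iff.2 ?_)
    have h1 : (f w.1).toReal ≤ w.2 := by
      rw [← EReal.coe_le_coe_iff, hf.coe_toReal (hdom w hw)]; exact hw
    have h2 : (f w'.1).toReal ≤ w'.2 := by
      rw [← EReal.coe_le_coe_iff, hf.coe_toReal (hdom w' hw')]; exact hw'
    simp only [Prod.snd_add, Prod.smul_snd, smul_eq_mul]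
    gcongr
  obtain ⟨L, c, hLx, hLS⟩ := geometric_hahn_banach_point_closed (x := (x, r)) hSconv hSclosed
    (fun h => (not_le.2 hr) h)
  let L₁ : StrongDual ℝ E := L.comp (ContinuousLinearMap.inl ℝ E ℝ)
  set s : ℝ := L (0, 1) with hs
  have hL : ∀ (y : E) (t : ℝ), L (y, t) = L₁ y + s * t := by
    intro y t
    have : (y, t) = (y, (0 : ℝ)) + t • ((0 : E), (1 : ℝ)) := by simp
    rw [this, map_add, map_smul, smul_eq_mul, mul_comm]
    rfl
  rw [hL] at hLx
  have hLf : ∀ y ∈ effDom f, ∀ t, (f y).toReal ≤ t → c < L₁ y + s * t := fun y hy t ht => by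
    rw [← hL]
    exact hLS _ (hmem y hy t ht)
  have hs0 : 0 ≤ s := by
    by_contra! hneg
    obtain ⟨y, hy⟩ := hf.nonempty
    have h1 := hLf y hy (max (f y).toReal ((L₁ y - c) / (-s))) (le_max_left _ _)
    have h2 : s * max (f y).toReal ((L₁ y - c) / (-s)) ≤ s * ((L₁ y - c) / (-s)) :=
      mul_le_mul_of_nonpos_left (le_max_right _ _) hneg.le
    have h3 : s * ((L₁ y - c) / (-s)) = -(L₁ y - c) := by
      have := hneg.ne
      field_simp
    linarith
  rcases hs0.eq_or_lt with hs0 | hspos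
  -- Vertical hyperplane: an affine minorant of f, tilted by a large multiple of the separating
  -- functional, exceeds r at x.
  · obtain ⟨v, hv⟩ := hne
    obtain ⟨c₀, hc₀⟩ : ∃ c₀ : ℝ, conjugate f v ≤ c₀ := by
      obtain ⟨c₀, hc₀, -⟩ := EReal.lt_iff_exists_real_btwn.1 (show conjugate f v < ⊤ from hv)
      exact ⟨c₀, hc₀.le⟩
    rw [hf.conjugate_le_iff] at hc₀
    simp only [← hs0, zero_mul, add_zero] at hLx hLf
    obtain ⟨n, hn⟩ := exists_nat_gt ((r - (v x - c₀)) / (c - L₁ x))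
    rw [div_lt_iff₀ (by linarith)] at hn
    refine ⟨v - (n : ℝ) • L₁, c₀ - n * c, hf.conjugate_le_iff.2 fun y hy => ?_, ?_⟩
    · have h1 := hc₀ y hy
      have h2 := mul_le_mul_of_nonneg_left (hLf y hy _ le_rfl).le (Nat.cast_nonneg (α := ℝ) n)
      rw [sub_apply, smul_apply, smul_eq_mul]
      linarith
    · rw [sub_apply, smul_apply, smul_eq_mul]
      linarith
  · have hdiv : ∀ y, s * (s⁻¹ * L₁ y) = L₁ y := fun y => by field_simp
    have hdivc : s * (s⁻¹ * c) = c := by field_simp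
    refine ⟨-(s⁻¹ • L₁), -(s⁻¹ * c), hf.conjugate_le_iff.2 fun y hy => ?_, ?_⟩
    · have h1 := hLf y hy _ le_rfl
      rw [neg_apply, smul_apply, smul_eq_mul]
      refine le_of_mul_le_mul_left ?_ hspos
      linarith [hdiv y]
    · rw [neg_apply, smul_apply, smul_eq_mul]
      refine lt_of_mul_lt_mul_left ?_ hspos.le
      linarith [hdiv x]

/-- If f(x) > u(x) - f*(u), biconjugation produces v with v(x) - f*(v) > u(x) - f*(u), against the
subgradient inequality for f* at u. Hence equality holds in Fenchel–Young. -/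
theorem IsGamma0.mem_subdiff_of_mem_subdiff_conjugate (hf : IsGamma0 f) {x : E}
    {u : StrongDual ℝ E} (hu : u ∈ effDom (conjugate f))
    (hx : NormedSpace.inclusionInDoubleDual ℝ E x ∈ subdiff (conjugate f) u) :
    u ∈ subdiff f x := by
  have hfc := hf.isGamma0_conjugate ⟨u, hu⟩
  have hle : f x ≤ ((u x - (conjugate f u).toReal : ℝ) : EReal) := by
    by_contra! hlt
    obtain ⟨v, c, hc, hr⟩ := hf.exists_conjugate_le_of_lt ⟨u, hu⟩ hlt
    have hv : v ∈ effDom (conjugate f) := hc.trans_lt (EReal.coe_lt_top _)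
    have h1 := (hfc.mem_subdiff_iff hu).1 hx v hv
    rw [NormedSpace.dual_def, sub_apply] at h1
    rw [← hfc.coe_toReal hv, EReal.coe_le_coe_iff] at hc
    linarith
  have hxd : x ∈ effDom f := hle.trans_lt (EReal.coe_lt_top _)
  refine (hf.mem_subdiff_iff hxd).2 fun y hy => ?_
  have h1 := hf.coe_le_conjugate u hy
  rw [← hfc.coe_toReal hu, EReal.coe_le_coe_iff] at h1
  rw [← hf.coe_toReal hxd, EReal.coe_le_coe_iff] at hle
  rw [map_sub]
  linarith

/-- A subgradient common to two points is a subgradient along their whole segment, so the segment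
lies in dom ∂f; the two subgradient inequalities at the midpoint then contradict strict convexity.
-/
theorem EssentiallyStrictlyConvex.eq_of_mem_subdiff (hs : EssentiallyStrictlyConvex f)
    (hf : IsGamma0 f) {x y : E} {u : StrongDual ℝ E} (hx : u ∈ subdiff f x)
    (hy : u ∈ subdiff f y) : x = y := by
  by_contra hne
  have hxd := hf.mem_effDom_of_mem_subdiff hx
  have hyd := hf.mem_effDom_of_mem_subdiff hy
  have hx' := (hf.mem_subdiff_iff hxd).1 hx
  have hy' := (hf.mem_subdiff_iff hyd).1 hy
  have hseg : segment ℝ x y ⊆ opDom (subdiff f) := by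
    rintro _ ⟨a, b, ha, hb, hab, rfl⟩
    have hwd := hf.convex_effDom hxd hyd ha hb hab
    refine ⟨u, (hf.mem_subdiff_iff hwd).2 fun t ht => ?_⟩
    have h1 := mul_le_mul_of_nonneg_left (hx' t ht) ha
    have h2 := mul_le_mul_of_nonneg_left (hy' t ht) hb
    have h3 := hf.convexOn_toReal.2 hxd hyd ha hb hab
    obtain rfl : b = 1 - a := by linarith
    simp only [map_sub, map_add, map_smul, smul_eq_mul] at h1 h2 h3 ⊢
    linarith
  have hlt := (hs.2 _ hseg (convex_segment x y)).2 (left_mem_segment ℝ x y)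
    (right_mem_segment ℝ x y) hne (show (0 : ℝ) < 1 / 2 by norm_num)
    (show (0 : ℝ) < 1 / 2 by norm_num) (by norm_num)
  have hwd : (1 / 2 : ℝ) • x + (1 / 2 : ℝ) • y ∈ effDom f :=
    hf.convex_effDom hxd hyd (by norm_num) (by norm_num) (by norm_num)
  have h1 := hx' _ hwd
  have h2 := hy' _ hwd
  simp only [map_sub, map_add, map_smul, smul_eq_mul] at h1 h2 hlt
  linarith

/-- The conjugate of an essentially strictly convex function on a reflexive space is Gâteaux
differentiable on the interior of its domain, and its gradient inverts the subdifferential. -/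
theorem EssentiallyStrictlyConvex.grad_conjugate (hE : IsReflexive E)
    (hs : EssentiallyStrictlyConvex f) (hf : IsGamma0 f) {x : E} {u : StrongDual ℝ E}
    (hu : u ∈ interior (effDom (conjugate f))) (hx : u ∈ subdiff f x) :
    grad (conjugate f) u = NormedSpace.inclusionInDoubleDual ℝ E x := by
  have hfc := hf.isGamma0_conjugate ⟨u, interior_subset hu⟩
  refine (hfc.hasGateauxGradAt_of_subdiff_subset hu fun G hG => ?_).grad_eq
  obtain ⟨y, rfl⟩ := hE G
  rw [hs.eq_of_mem_subdiff hf hx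
    (hf.mem_subdiff_of_mem_subdiff_conjugate (interior_subset hu) hG)]
  exact mem_singleton _

theorem IsGamma0.exists_mem_subdiff_of_mem_interior_conjugate (hE : IsReflexive E)
    (hf : IsGamma0 f) {u : StrongDual ℝ E} (hu : u ∈ interior (effDom (conjugate f))) :
    ∃ x, u ∈ subdiff f x := by
  have hfc := hf.isGamma0_conjugate ⟨u, interior_subset hu⟩
  obtain ⟨G, hG⟩ := hfc.nonempty_subdiff hu
  obtain ⟨x, rfl⟩ := hE G
  exact ⟨x, hf.mem_subdiff_of_mem_subdiff_conjugate (interior_subset hu) hG⟩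

end Conjugate

/-! ### From bounded Bregman distances to interior weak limits. -/

section BoundedBregman

variable {E : Type*} [NormedAddCommGroup E] [NormedSpace ℝ E] [CompleteSpace E] {f : E → EReal}

/-- If `f` is essentially smooth and `∇f*` is weakly sequentially continuous on the open set
`dom f*`, a sequence with bounded Bregman distances to an interior point has its weak limits in the
interior of the domain. -/
theorem EssentiallySmooth.mem_interior_of_weaklySeqContinuousOn (hE : IsReflexive E)
    (hs : EssentiallySmooth f) (hf : IsGamma0 f) (hsc : EssentiallyStrictlyConvex f)
    (hopen : IsOpen (effDom (conjugate f)))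
    (hweak : WeaklySeqContinuousOn (grad (conjugate f)) (interior (effDom (conjugate f))))
    {z : E} (hz : z ∈ interior (effDom f)) {y : ℕ → E} {K : ℝ}
    (hy : ∀ n, y n ∈ interior (effDom f))
    (hK : ∀ n, (f z).toReal - (f (y n)).toReal - grad f (y n) (z - y n) ≤ K)
    {x : E} (hyx : WeakTendsto y x) : x ∈ interior (effDom f) := by
  obtain ⟨R, hR⟩ := hs.exists_norm_grad_le hf hz K
  have hsub : ∀ n, grad f (y n) ∈ subdiff f (y n) := fun n => hs.grad_mem_subdiff hf (hy n)
  obtain ⟨u, k, hk, hu⟩ := hE.exists_weakTendsto_subseq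
    (u := fun n => grad f (y n)) (fun n => hR _ (hy n) (hK n))
  have hlim : ∀ w, Tendsto (fun n => grad f (y (k n)) w) atTop (𝓝 (u w)) := fun w =>
    weakTendsto_iff.1 hu (NormedSpace.inclusionInDoubleDual ℝ E w)
  -- Since f*(∇f(y)) = D_f(z, y) + ⟨z, ∇f(y)⟩ - f(z), the conjugate is bounded along the gradients,
  -- and the bound survives the weak limit.
  have hudom : u ∈ interior (effDom (conjugate f)) := by
    rw [hopen.interior_eq]
    refine lt_of_le_of_lt ((hf.conjugate_le_iff (c := K + R * ‖z‖ - (f z).toReal)).2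
      fun w hw => ?_) (EReal.coe_lt_top _)
    refine le_of_tendsto' ((hlim w).sub_const _) fun n => ?_
    have h1 := hs.grad_le hf (hy (k n)) hw
    have h2 := hK (k n)
    have h3 : grad f (y (k n)) z ≤ R * ‖z‖ :=
      (le_abs_self _).trans ((grad f (y (k n))).le_of_opNorm_le (hR _ (hy (k n)) (hK (k n))) z)
    rw [map_sub] at h1 h2
    linarith
  have hgdom : ∀ n, grad f (y n) ∈ interior (effDom (conjugate f)) := fun n => by
    rw [hopen.interior_eq]
    exact hf.mem_effDom_conjugate (hsub n)
  obtain ⟨x', hx'⟩ := hf.exists_mem_subdiff_of_mem_interior_conjugate hE hudom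
  have hconv := hweak _ (fun n => hgdom (k n)) u hudom hu
  rw [hsc.grad_conjugate hE hf hudom hx', weakTendsto_iff] at hconv
  have hxx' : NormedSpace.inclusionInDoubleDual ℝ E x =
      NormedSpace.inclusionInDoubleDual ℝ E x' := by
    ext φ
    have h1 := hconv (NormedSpace.inclusionInDoubleDual ℝ (StrongDual ℝ E) φ)
    have h2 := (weakTendsto_iff.1 hyx φ).comp hk.tendsto_atTop
    refine tendsto_nhds_unique h2 (h1.congr fun n => ?_)
    show grad (conjugate f) (grad f (y (k n))) φ = φ (y (k n))
    rw [hsc.grad_conjugate hE hf (hgdom (k n)) (hsub (k n)), NormedSpace.dual_def]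
  have hx : x = x' := (NormedSpace.inclusionInDoubleDualLi (E := E) ℝ).injective hxx'
  exact hs.opDom_subdiff_subset hf ⟨z, hz⟩ ⟨u, hx ▸ hx'⟩

/-- If the Bregman symmetry ratio of `f` is positive, a sequence with bounded Bregman distances to
an interior point has its weak limits in the interior of the domain. -/
theorem EssentiallySmooth.mem_interior_of_bregmanSymmetryRatio_pos (hE : IsReflexive E)
    (hs : EssentiallySmooth f) (hf : IsGamma0 f) (hρ : 0 < bregmanSymmetryRatio f)
    {z : E} (hz : z ∈ interior (effDom f)) {y : ℕ → E} {K : ℝ}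
    (hy : ∀ n, y n ∈ interior (effDom f))
    (hK : ∀ n, (f z).toReal - (f (y n)).toReal - grad f (y n) (z - y n) ≤ K)
    {x : E} (hyx : WeakTendsto y x) : x ∈ interior (effDom f) := by
  set D : E → E → ℝ := fun a b => (f a).toReal - (f b).toReal - grad f b (a - b) with hD
  have hD0 : ∀ a ∈ effDom f, ∀ b ∈ interior (effDom f), 0 ≤ D a b := fun a ha b hb => by
    have := hs.grad_le hf hb ha
    simp only [hD]
    linarith
  obtain ⟨ρ, hρ0, hρlt⟩ := EReal.lt_iff_exists_real_btwn.1 hρ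
  have hρ0' : 0 < ρ := EReal.coe_pos.1 hρ0
  have hratio : ∀ a ∈ interior (effDom f), ∀ b ∈ interior (effDom f), ρ * D b a ≤ D a b := by
    intro a ha b hb
    rcases eq_or_ne a b with rfl | hne
    · simp [hD]
    have h1 : (ρ : EReal) ≤ bregman f a b / bregman f b a :=
      hρlt.le.trans (iInf₂_le_of_le a ha (iInf₂_le_of_le b hb (iInf_le _ hne)))
    rw [hf.bregman_eq (interior_subset ha) hb, hf.bregman_eq (interior_subset hb) ha,
      ← EReal.coe_div, EReal.coe_le_coe_iff] at h1
    change ρ ≤ D a b / D b a at h1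
    rcases (hD0 b (interior_subset hb) a ha).eq_or_lt with h0 | h0
    · rw [← h0, mul_zero]
      exact hD0 a (interior_subset ha) b hb
    · rwa [le_div_iff₀ h0] at h1
  -- The ratio bounds D_f(y n, z), hence f(y n) from above; convex closed sublevel sets retain the
  -- weak limit.
  have hxdom : x ∈ effDom f := by
    obtain ⟨c, hc⟩ := (weakTendsto_iff.1 hyx (grad f z)).bddAbove_range
    have hbd : ∀ n, f (y n) ≤ ((K / ρ + (f z).toReal + c - grad f z z : ℝ) : EReal) := fun n => by
      have h1 := (hratio z hz (y n) (hy n)).trans (hK n)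
      rw [← le_div_iff₀' hρ0'] at h1
      have h2 : grad f z (y n) ≤ c := hc (mem_range_self n)
      simp only [hD, map_sub] at h1
      rw [← hf.coe_toReal (interior_subset (hy n)), EReal.coe_le_coe_iff]
      linarith
    have hmem := hyx.mem_of_isClosed_of_convex (hf.isClosed_sublevel _) (hf.convex_sublevel _) hbd
    rw [mem_ofPred_eq] at hmem
    exact hmem.trans_lt (EReal.coe_lt_top _)
  let t : ℕ → ℝ := fun n => 1 / ((n : ℝ) + 1)
  have ht0 : ∀ n, 0 < t n := fun n => by positivity
  have ht1 : ∀ n, t n ≤ 1 := fun n => by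
    rw [div_le_one (by positivity)]
    simp
  -- Points of the segment from z converge strongly to x. There D_f(w n, z) ≤ D_f(x, z) by
  -- convexity, and the ratio reverses the arguments to bound D_f(z, w n).
  let w : ℕ → E := fun n => t n • z + (1 - t n) • x
  have hw : ∀ n, w n ∈ interior (effDom f) := fun n =>
    hf.convex_effDom.combo_interior_self_mem_interior hz hxdom (ht0 n)
      (by linarith [ht1 n]) (by ring)
  have hwlim : Tendsto w atTop (𝓝 x) := by
    have h1 : Tendsto t atTop (𝓝 0) := tendsto_one_div_add_atTop_nhds_zero_nat
    have h2 := (h1.smul_const z).add ((h1.const_sub 1).smul_const x)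
    simpa using h2
  obtain ⟨R, hR⟩ := hs.exists_norm_grad_le hf hz (D x z / ρ)
  refine hs.mem_interior_of_tendsto hE hf hw (fun n => hR _ (hw n) ?_) hwlim
  have h1 : D (w n) z ≤ D x z := by
    have h2 := hf.convexOn_toReal.2 (interior_subset hz) hxdom (ht0 n).le
      (sub_nonneg.2 (ht1 n)) (by ring)
    have h3 := mul_nonneg (ht0 n).le (hD0 x hxdom z hz)
    have h4 : grad f z (w n - z) = (1 - t n) * grad f z (x - z) := by
      rw [show w n - z = (1 - t n) • (x - z) by simp only [w]; module, map_smul, smul_eq_mul]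
    simp only [hD, h4, smul_eq_mul] at h2 h3 ⊢
    change (f (w n)).toReal ≤ _ at h2
    linarith
  rw [le_div_iff₀' hρ0']
  exact (hratio (w n) (hw n) z hz).trans h1

end BoundedBregman

/-! ### Boundedness along the iterates. -/

section Algorithm

variable {X : Type*} [NormedAddCommGroup X] [NormedSpace ℝ X]
  {A B : X → Set (StrongDual ℝ X)} {f : X → EReal} {δ₁ δ₂ κ α : ℝ}
  {γ : ℕ → ℝ} {fs : ℕ → X → EReal} {x : ℕ → X}

theorem GeneratedByAlgorithm.exists_step (hx : GeneratedByAlgorithm A B f δ₁ δ₂ κ α γ fs x)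
    (n : ℕ) : x (n + 1) ∈ setC A f ∧ ∃ a ∈ A (x (n + 1)), ∃ b ∈ B (x n),
      grad (fs n) (x (n + 1)) + γ n • a = grad (fs n) (x n) - γ n • b := by
  obtain ⟨b, hb, hmem⟩ := hx.step n
  obtain ⟨g, hg, -, ⟨a, ha, rfl⟩, hga⟩ := hmem
  have hg' : HasGateauxGradAt (fs n) g (x (n + 1)) := hg
  refine ⟨⟨?_, a, ha⟩, a, ha, b, hb, ?_⟩
  · rw [← (hx.kernels n).dom_eq]
    exact hg'.1
  · rw [hg'.grad_eq]
    exact hga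

theorem GeneratedByAlgorithm.mem_setC (hx : GeneratedByAlgorithm A B f δ₁ δ₂ κ α γ fs x) :
    ∀ n, x n ∈ setC A f
  | 0 => hx.start
  | n + 1 => (hx.exists_step n).1

/-- The Bregman distances from a solution to the iterates are bounded. -/
theorem GeneratedByAlgorithm.exists_bregman_le [CompleteSpace X]
    (hx : GeneratedByAlgorithm A B f δ₁ δ₂ κ α γ fs x) {z : X} (hz : z ∈ solSet A B f) :
    ∃ K : ℝ, ∀ n, (f z).toReal - (f (x n)).toReal - grad f (x n) (z - x n) ≤ K := by
  have hset := hx.setting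
  have hf := hset.gamma0
  have hs := hset.essSmooth
  have hxC := hx.mem_setC
  have hxi : ∀ n, x n ∈ interior (effDom f) := fun n => (hxC n).1
  have hzi : z ∈ interior (effDom f) := hz.1
  obtain ⟨as, has, bz, hbz, hab⟩ := hz.2
  have hzC : z ∈ setC A f := ⟨hzi, as, has⟩
  choose a ha b hb hstep using fun n => (hx.exists_step n).2
  obtain ⟨a₀, ha₀⟩ := hx.start.2
  -- The starting point comes with no element of A selected by the algorithm, so any a₀ ∈ A(x 0) is
  -- used at index 0.
  let xs : ℕ → StrongDual ℝ X := fun n => Nat.casesOn n a₀ a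
  have hxs : ∀ n, xs n ∈ A (x n) := fun n => by
    cases n with
    | zero => exact ha₀
    | succ n => exact ha n
  have hstep' : ∀ n,
      grad (fs n) (x (n + 1)) + γ n • xs (n + 1) = grad (fs n) (x n) - γ n • b n := hstep
  set Df : X → X → ℝ := fun u v => (f u).toReal - (f v).toReal - grad f v (u - v) with hDf
  set D : ℕ → X → X → ℝ := fun n u v =>
    (fs n u).toReal - (fs n v).toReal - grad (fs n) v (u - v) with hD
  have hDf0 : ∀ u ∈ interior (effDom f), ∀ v ∈ interior (effDom f), 0 ≤ Df u v :=
    fun u hu v hv => by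
      have := hs.grad_le hf hv (interior_subset hu)
      simp only [hDf]
      linarith
  have hbreg : ∀ n, ∀ u ∈ interior (effDom f), ∀ v ∈ interior (effDom f),
      bregman (fs n) u v = (D n u v : EReal) := fun n u hu v hv => by
    have hdom := (hx.kernels n).dom_eq
    exact (hx.kernels n).gamma0.bregman_eq (hdom ▸ interior_subset hu) (hdom ▸ hv)
  have hαD : ∀ n, ∀ u ∈ interior (effDom f), ∀ v ∈ interior (effDom f),
      α * Df u v ≤ D n u v := fun n u hu v hv => by
    have := (hx.kernels n).bregman_ge u v
    rw [hbreg n u hu v hv, hf.bregman_eq (interior_subset hu) hv, ← EReal.coe_mul,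
      EReal.coe_le_coe_iff] at this
    exact this
  have hD0 : ∀ n, ∀ u ∈ interior (effDom f), ∀ v ∈ interior (effDom f), 0 ≤ D n u v :=
    fun n u hu v hv => (mul_nonneg hx.α_pos.le (hDf0 u hu v hv)).trans (hαD n u hu v hv)
  obtain ⟨η, hη0, hηsum, hη⟩ := hx.bregman_le
  have hDle : ∀ n, ∀ u ∈ interior (effDom f), ∀ v ∈ interior (effDom f),
      D (n + 1) u v ≤ (1 + η n) * D n u v := fun n u hu v hv => by
    have := hη n u v
    rw [hbreg n u hu v hv, hbreg (n + 1) u hu v hv, ← EReal.coe_mul, EReal.coe_le_coe_iff] at this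
    exact this
  set m : ℕ → ℝ := fun n => (xs n - as) (x n - z) with hm
  have hm0 : ∀ n, 0 ≤ m n := fun n => hset.maxMono_A.1 _ _ _ (hxs n) _ has
  have hbz_eq : bz = -as := eq_neg_of_add_eq_zero_right hab
  have hineq : ∀ n, (b n - bz) (x n - x (n + 1)) ≤
      κ * Df (x (n + 1)) (x n) + (δ₁ * m n + δ₂ * (b n - bz) (x n - z)) := fun n => by
    have := hset.ineq (x (n + 1)) (hxC (n + 1)) (x n) (hxC n) z hz (xs n) (hxs n) as has
      (b n) (hb n) bz hbz
    rw [hf.bregman_eq (interior_subset (hxi (n + 1))) (hxi n), ← EReal.coe_mul, ← EReal.coe_add,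
      EReal.coe_le_coe_iff] at this
    exact this
  -- The step, tested against x (n + 1) - z, is combined with the three-point identity for D_{f_n}.
  -- The κ-term is absorbed by κγ_n ≤ α and D_{f_n} ≥ αD_f, the δ₂-term by monotonicity of B and δ₂
  -- ≤ 1.
  have hdescent : ∀ n, D n z (x (n + 1)) + γ n * m (n + 1) ≤ D n z (x n) + δ₁ * γ n * m n := by
    intro n
    have hγ := hx.γ_pos n
    have hmB : 0 ≤ (b n - bz) (x n - z) := hset.maxMono_B.1 _ _ _ (hb n) _ hbz
    have h1 : γ n * (κ * Df (x (n + 1)) (x n)) ≤ D n (x (n + 1)) (x n) := by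
      refine le_trans ?_ (hαD n _ (hxi (n + 1)) _ (hxi n))
      rw [← mul_assoc, mul_comm (γ n)]
      exact mul_le_mul_of_nonneg_right (hx.sup_κγ n) (hDf0 _ (hxi (n + 1)) _ (hxi n))
    have h2 := mul_le_mul_of_nonneg_left (hineq n) hγ.le
    have h3 : γ n * (δ₂ * (b n - bz) (x n - z)) ≤ γ n * (b n - bz) (x n - z) :=
      mul_le_mul_of_nonneg_left (mul_le_of_le_one_left hmB hset.δ₂_mem.2) hγ.le
    have h4 := DFunLike.congr_fun (hstep' n) (x (n + 1) - z)
    have h5 : γ n * m (n + 1) + γ n * ((b n - bz) (x n - z) - (b n - bz) (x n - x (n + 1))) =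
        D n z (x n) - D n z (x (n + 1)) - D n (x (n + 1)) (x n) := by
      subst hbz_eq
      simp only [add_apply, sub_apply, smul_apply, smul_eq_mul, map_sub] at h4
      simp only [hm, hD, sub_apply, neg_apply, map_sub]
      linarith
    have h6 : γ n * (δ₁ * m n) = δ₁ * γ n * m n := by ring
    rw [mul_add, mul_add, h6] at h2
    linarith
  obtain ⟨q, hq1, hq⟩ := hx.sup_ratio
  -- The Lyapunov quantity: δ₁γ_{n+1} ≤ γ_n lets the A-term gained at one step pay for the one
  -- needed at the next.
  set Δ : ℕ → ℝ := fun n => D n z (x n) + δ₁ * γ n * m n with hΔ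
  have hΔ0 : ∀ n, 0 ≤ Δ n := fun n =>
    add_nonneg (hD0 n _ hzi _ (hxi n))
      (mul_nonneg (mul_nonneg hset.δ₁_mem.1 (hx.γ_pos n).le) (hm0 n))
  have hΔstep : ∀ n, Δ (n + 1) ≤ (1 + η n) * Δ n := fun n => by
    have hγ : δ₁ * γ (n + 1) ≤ γ n := by
      have := (hq n).trans hq1.le
      rwa [div_le_one (hx.γ_pos n)] at this
    have h1 := hDle n _ hzi _ (hxi (n + 1))
    have h2 := mul_le_mul_of_nonneg_right hγ (hm0 (n + 1))
    have h3 : 0 ≤ η n * (γ n * m (n + 1)) :=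
      mul_nonneg (hη0 n) (mul_nonneg (hx.γ_pos n).le (hm0 (n + 1)))
    have h4 := mul_le_mul_of_nonneg_left (hdescent n) (add_nonneg zero_le_one (hη0 n))
    simp only [hΔ]
    linarith
  have hΔexp : ∀ n, Δ n ≤ Real.exp (∑ i ∈ Finset.range n, η i) * Δ 0 := fun n => by
    induction n with
    | zero => simp
    | succ n ih =>
      rw [Finset.sum_range_succ, add_comm (∑ i ∈ Finset.range n, η i), Real.exp_add, mul_assoc]
      refine (hΔstep n).trans ?_
      have h1 : 1 + η n ≤ Real.exp (η n) := by
        rw [add_comm]; exact Real.add_one_le_exp _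
      exact mul_le_mul h1 ih (hΔ0 n) (Real.exp_pos _).le
  refine ⟨Real.exp (∑' i, η i) * Δ 0 / α, fun n => ?_⟩
  rw [le_div_iff₀' hx.α_pos]
  calc α * Df z (x n) ≤ D n z (x n) := hαD n _ hzi _ (hxi n)
    _ ≤ Δ n := le_add_of_nonneg_right
        (mul_nonneg (mul_nonneg hset.δ₁_mem.1 (hx.γ_pos n).le) (hm0 n))
    _ ≤ Real.exp (∑ i ∈ Finset.range n, η i) * Δ 0 := hΔexp n
    _ ≤ Real.exp (∑' i, η i) * Δ 0 := by
        refine mul_le_mul_of_nonneg_right (Real.exp_le_exp.2 ?_) (hΔ0 0)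
        exact hηsum.sum_le_tsum _ fun i _ => hη0 i

end Algorithm

end BregmanFB

/-! ### The proposition: cases [a] to [d]. -/

open BregmanFB
theorem propositionp {X : Type*} [NormedAddCommGroup X] [NormedSpace ℝ X] [CompleteSpace X]
    (hX : IsReflexive X)
    (A B : X → Set (StrongDual ℝ X)) (f : X → EReal) (δ₁ δ₂ κ α : ℝ)
    (γ : ℕ → ℝ) (fs : ℕ → X → EReal) (x : ℕ → X)
    (hx : GeneratedByAlgorithm A B f δ₁ δ₂ κ α γ fs x)
    (h :
      (closure (effDom f) ∩ closure (opDom A) ⊆ interior (effDom f)) ∨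
      (EssentiallyStrictlyConvex f ∧ IsOpen (effDom (conjugate f)) ∧
        WeaklySeqContinuousOn (grad (conjugate f)) (interior (effDom (conjugate f)))) ∨
      (StrictConvexOn ℝ (interior (effDom f)) (fun u => (f u).toReal) ∧
        bregmanSymmetryRatio f ∈ Set.Ioo (0 : EReal) ⊤) ∨
      FiniteDimensional ℝ X) :
    weakSeqClusterPts x ⊆ interior (effDom f) := by
  rintro l ⟨k, -, hl⟩
  have hf := hx.setting.gamma0
  have hs := hx.setting.essSmooth
  obtain ⟨z, hz⟩ := hx.setting.sol_nonempty
  obtain ⟨K, hK⟩ := hx.exists_bregman_le hz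
  have hmem : ∀ n, (x ∘ k) n ∈ interior (effDom f) := fun n => (hx.mem_setC (k n)).1
  rcases h with h | ⟨hsc, hopen, hweak⟩ | ⟨-, hρ, -⟩ | hfin
  · refine h ⟨?_, hx.setting.maxMono_A.mem_closure_opDom hX
      (fun n => (hx.mem_setC (k n)).2) hl⟩
    exact hl.mem_of_isClosed_of_convex isClosed_closure hf.convex_effDom.closure
      fun n => subset_closure (interior_subset (hmem n))
  · exact hs.mem_interior_of_weaklySeqContinuousOn hX hf hsc hopen hweak hz.1 hmem
      (fun n => hK (k n)) hl
  · exact hs.mem_interior_of_bregmanSymmetryRatio_pos hX hf hρ hz.1 hmem (fun n => hK (k n)) hl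
  · obtain ⟨R, hR⟩ := hs.exists_norm_grad_le hf hz.1 K
    exact hs.mem_interior_of_tendsto hX hf hmem (fun n => hR _ (hmem n) (hK (k n)))
      hl.tendsto_of_finiteDimensional
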